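/- **Theorem 1.** Let $X_+$ and $X_-$ be locally finite buildings of the same type $(W,S)$ ($S$ finite), and let $G_+$ and $G_-$ be locally compact (Hausdorff) groups acting on $X_+$ and $X_-$, respectively, by type-preserving automorphisms, strongly transitively (that is, for some invariant system of apartments, transitively on the pairs consisting of an apartment and a chamber in it), and continuously and properly (that is, the stabilizers of chambers are open and compact; this holds, for instance, for closed subgroups of the automorphism groups of $X_\pm$). Let $\Gamma$ be a twin building lattice in $G = G_+ \times G_-$, that is, a lattice $\Gamma < G$ (a discrete subgroup such that $G/\Gamma$ carries a nonzero finite $G$-invariant Borel measure) which is irreducible, in the sense that its projections to $G_+$ and to $G_-$ are dense, and which preserves a twinning between $X_+$ and $X_-$. Then $\Gamma$ is undistorted in $G$: the group $\Gamma$ is finitely generated, $G$ is compactly generated, and for every finite generating set $\Sigma$ of $\Gamma$ and every compact generating set $\widehat\Sigma$ of $G$ the inclusion $(\Gamma, d_\Sigma) \to (G, d_{\widehat\Sigma})$ is a quasi-isometric embedding for the associated word metrics, that is, there are constants $L \geq 1$ and $C \geq 0$ such that $$\frac{1}{L}\, d_\Sigma(\gamma,\gamma') - C \;\leq\; d_{\widehat\Sigma}(\gamma,\gamma')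 \;\leq\; L\, d_\Sigma(\gamma,\gamma') + C \qquad \text{for all } \gamma, \gamma' \in \Gamma.$$ -/

import Mathlib

/-! ### Buildings and twinnings as `W`-metric spaces -/

/-- A building of type `(W, S)` with set of chambers `X`, given by its Weyl distance `δ`.
Here `(W, S)` is the Coxeter system `cs`, with `S = {cs.simple i}`. -/
structure Building {B W : Type*} [Group W] {M : CoxeterMatrix B} (cs : CoxeterSystem M W)
    (X : Type*) where
  /-- the Weyl distance -/
  δ : X → X → W
  nonempty : Nonempty X
  δ_eq_one_iff : ∀ c d : X, δ c d = 1 ↔ c = d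
  δ_eq_or : ∀ (c' c d : X) (i : B), δ c' c = cs.simple i →
    δ c' d = cs.simple i * δ c d ∨ δ c' d = δ c d
  δ_of_length : ∀ (c' c d : X) (i : B), δ c' c = cs.simple i →
    cs.length (cs.simple i * δ c d) = cs.length (δ c d) + 1 → δ c' d = cs.simple i * δ c d
  exists_δ : ∀ (c d : X) (i : B), ∃ c' : X,
    δ c' c = cs.simple i ∧ δ c' d = cs.simple i * δ c d

namespace Building

variable {B W : Type*} [Group W] {M : CoxeterMatrix B} {cs : CoxeterSystem M W} {X : Type*}

/-- `A` is an apartment: the image of an isometric embedding `W → X`, where `W` carries the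
Weyl distance `(u, v) ↦ u⁻¹ * v`. -/
def IsApartment (Δ : Building cs X) (A : Set X) : Prop :=
  ∃ α : W → X, (∀ u v : W, Δ.δ (α u) (α v) = u⁻¹ * v) ∧ A = Set.range α

/-- `𝒜` is a system of apartments: any two chambers lie in a common member of `𝒜`. -/
def IsApartmentSystem (Δ : Building cs X) (𝒜 : Set (Set X)) : Prop :=
  (∀ A ∈ 𝒜, Δ.IsApartment A) ∧ ∀ c d : X, ∃ A ∈ 𝒜, c ∈ A ∧ d ∈ A

/-- The building is locally finite: finite rank and finite panels. -/
def IsLocallyFinite (Δ : Building cs X) : Prop :=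
  Finite B ∧ ∀ (c : X) (i : B), {d : X | Δ.δ c d = cs.simple i}.Finite

/-- The group `G` acts strongly transitively: it acts by type-preserving automorphisms, and, for
some `G`-invariant system of apartments, it is transitive on the pairs consisting of an apartment
and a chamber in it. -/
def IsStronglyTransitive (Δ : Building cs X) (G : Type*) [Group G] [MulAction G X] : Prop :=
  (∀ (g : G) (c d : X), Δ.δ (g • c) (g • d) = Δ.δ c d) ∧
  ∃ 𝒜 : Set (Set X), Δ.IsApartmentSystem 𝒜 ∧
    (∀ (g : G), ∀ A ∈ 𝒜, (fun x : X => g • x) '' A ∈ 𝒜) ∧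
    ∀ A ∈ 𝒜, ∀ A' ∈ 𝒜, ∀ c ∈ A, ∀ c' ∈ A', ∃ g : G, g • c = c' ∧ (fun x : X => g • x) '' A = A'

end Building

/-- A twinning between two buildings `Δp`, `Δm` of the same type, given by the codistance
`δs c d = δ*(c, d)` for `c` positive and `d` negative. The codistance in the other order is
`δ*(d, c) = δ*(c, d)⁻¹`, and the axioms for `δ*(d, c)` are written out through it. -/
structure Twinning {B W : Type*} [Group W] {M : CoxeterMatrix B} {cs : CoxeterSystem M W}
    {Xp Xm : Type*} (Δp : Building cs Xp) (Δm : Building cs Xm) where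
  /-- the codistance -/
  δs : Xp → Xm → W
  pos_of_length : ∀ (c' c : Xp) (d : Xm) (i : B), Δp.δ c' c = cs.simple i →
    cs.length (cs.simple i * δs c d) < cs.length (δs c d) → δs c' d = cs.simple i * δs c d
  pos_exists : ∀ (c : Xp) (d : Xm) (i : B), ∃ c' : Xp,
    Δp.δ c' c = cs.simple i ∧ δs c' d = cs.simple i * δs c d
  neg_of_length : ∀ (d' d : Xm) (c : Xp) (i : B), Δm.δ d' d = cs.simple i →
    cs.length (cs.simple i * (δs c d)⁻¹) < cs.length ((δs c d)⁻¹) →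
    (δs c d')⁻¹ = cs.simple i * (δs c d)⁻¹
  neg_exists : ∀ (d : Xm) (c : Xp) (i : B), ∃ d' : Xm,
    Δm.δ d' d = cs.simple i ∧ (δs c d')⁻¹ = cs.simple i * (δs c d)⁻¹

/-! ### Lattices and word metrics -/

/-- `Γ` is a lattice in the topological group `G`: it is discrete, and `G ⧸ Γ` carries a nonzero
finite Borel measure which is invariant under left translation by `G`. -/
def Subgroup.IsLatticeIn {G : Type*} [Group G] [TopologicalSpace G] (Γ : Subgroup G) : Prop :=
  DiscreteTopology Γ ∧
  ∃ μ : @MeasureTheory.Measure (G ⧸ Γ) (borel (G ⧸ Γ)),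
    μ ≠ 0 ∧ μ Set.univ ≠ ⊤ ∧
    ∀ (g : G) (E : Set (G ⧸ Γ)), @MeasurableSet (G ⧸ Γ) (borel (G ⧸ Γ)) E →
      μ ((fun x : G ⧸ Γ => g • x) ⁻¹' E) = μ E

/-- The word length of `g` with respect to `S`: the least length of a word in `S ∪ S⁻¹` that
represents `g` (used only when `S` generates the group). -/
noncomputable def wordLength {G : Type*} [Group G] (S : Set G) (g : G) : ℕ :=
  sInf {n : ℕ | ∃ l : List G, (∀ x ∈ l, x ∈ S ∨ x⁻¹ ∈ S) ∧ l.prod = g ∧ l.length = n}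

/-- The (left-invariant) word metric with respect to `S`. -/
noncomputable def wordDist {G : Type*} [Group G] (S : Set G) (g h : G) : ℝ :=
  (wordLength S (g⁻¹ * h) : ℝ)

/-- `S` is a generating set of the group `G`. -/
def IsGenerating {G : Type*} [Group G] (S : Set G) : Prop := Subgroup.closure S = ⊤

/-- `f` is a quasi-isometric embedding with respect to the distance functions `dX` and `dY`. -/
def IsQuasiIsometricEmbedding {X Y : Type*} (dX : X → X → ℝ) (dY : Y → Y → ℝ) (f : X → Y) : Prop :=
  ∃ L C : ℝ, 1 ≤ L ∧ 0 ≤ C ∧ ∀ x x' : X,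
    L⁻¹ * dX x x' - C ≤ dY (f x) (f x') ∧ dY (f x) (f x') ≤ L * dX x x' + C

/-- `Γ` is undistorted in `G`: `Γ` is finitely generated, `G` is compactly generated, and for
all finite generating sets `S` of `Γ` and all compact generating sets `T` of `G` the inclusion of
`Γ` in `G` is a quasi-isometric embedding for the word metrics of `S` and `T`. -/
def Subgroup.IsUndistorted {G : Type*} [Group G] [TopologicalSpace G] (Γ : Subgroup G) : Prop :=
  (∃ S : Set Γ, S.Finite ∧ IsGenerating S) ∧
  (∃ T : Set G, IsCompact T ∧ IsGenerating T) ∧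
  ∀ (S : Set Γ) (T : Set G), S.Finite → IsGenerating S → IsCompact T → IsGenerating T →
    IsQuasiIsometricEmbedding (wordDist S) (wordDist T) (fun γ : Γ => (γ : G))

/-! ### Twin building lattices -/

/-- `G` acts continuously and properly on the discrete set `X`: the point stabilizers are open
and compact. -/
def HasCompactOpenStabilizers (G X : Type*) [Group G] [TopologicalSpace G] [MulAction G X] : Prop :=
  ∀ x : X, IsOpen (MulAction.stabilizer G x : Set G) ∧ IsCompact (MulAction.stabilizer G x : Set G)

/-- `Γ < Gp × Gm` is a twin building lattice associated with the twinning `τ` between the buildings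
`Δp` and `Δm`, on which the locally compact groups `Gp` and `Gm` act. -/
structure IsTwinBuildingLattice {B W : Type*} [Group W] {M : CoxeterMatrix B}
    {cs : CoxeterSystem M W} {Xp Xm : Type*} {Δp : Building cs Xp} {Δm : Building cs Xm}
    (τ : Twinning Δp Δm)
    {Gp Gm : Type*} [Group Gp] [Group Gm] [TopologicalSpace Gp] [TopologicalSpace Gm]
    [MulAction Gp Xp] [MulAction Gm Xm] (Γ : Subgroup (Gp × Gm)) : Prop where
  locallyFinite_pos : Δp.IsLocallyFinite
  locallyFinite_neg : Δm.IsLocallyFinite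
  proper_pos : HasCompactOpenStabilizers Gp Xp
  proper_neg : HasCompactOpenStabilizers Gm Xm
  stronglyTransitive_pos : Δp.IsStronglyTransitive Gp
  stronglyTransitive_neg : Δm.IsStronglyTransitive Gm
  lattice : Γ.IsLatticeIn
  /-- irreducibility -/
  dense_pos : Dense (Prod.fst '' (Γ : Set (Gp × Gm)))
  dense_neg : Dense (Prod.snd '' (Γ : Set (Gp × Gm)))
  /-- `Γ` preserves the twinning -/
  preserves : ∀ γ ∈ Γ, ∀ (c : Xp) (d : Xm), τ.δs (γ.1 • c) (γ.2 • d) = τ.δs c d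

/-! The opposite pairs of chambers, joined when their components are equal or adjacent, serve as a
Cayley graph for `Γ`. Two facts carry the proof.

Geometry: two opposite pairs are joined by a chain of opposite pairs whose length is linear in their
distance in `Xp × Xm` (`Twinning.exists_chain_opposite`). The graph is thus undistorted in the
product of the buildings.

Finiteness: `Γ` has finitely many orbits on opposite pairs, whether or not it is cocompact in `G`.
Finite covolume bounds the number of orbits in any set of pairs whose stabilizers in `Γ` have
bounded order (`Subgroup.IsLatticeIn.exists_finite_representatives`); the unimodularity this needs
is a count of spheres. The stabilizers of opposite pairs are bounded by rigidity
(`Twinning.IsAut.eq_id`): up to the finite kernel of the action, an element fixing such a pair is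
determined by its action near one chamber. Crossing a panel in the rigidity argument takes a third
chamber, so the panels with two chambers are absorbed into residues, which are finite, again by
finite covolume.

A Milnor–Schwarz argument then bounds word length in `Γ` by the displacement of a base pair, which
is at most linear in word length in `G`. -/

namespace Building

variable {B W : Type*} [Group W] {M : CoxeterMatrix B} {cs : CoxeterSystem M W} {X : Type*}
  (Δ : Building cs X)

/-! ### Weyl distance: symmetry and the triangle inequality -/

theorem δ_self (c : X) : Δ.δ c c = 1 := (Δ.δ_eq_one_iff c c).2 rfl

variable {Δ} in
theorem δ_simple_symm {c d : X} {i : B} (h : Δ.δ c d = cs.simple i) :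
    Δ.δ d c = cs.simple i := by
  have hne : cs.simple i ≠ 1 := fun h1 => by simpa [h1] using cs.length_simple i
  rcases Δ.δ_eq_or c d c i h with h1 | h1
  · rw [Δ.δ_self] at h1
    rw [eq_comm, ← eq_inv_mul_iff_mul_eq] at h1
    simpa using h1
  · rw [Δ.δ_self, eq_comm, Δ.δ_eq_one_iff] at h1
    subst h1
    exact absurd (h.symm.trans (Δ.δ_self _)) hne

/-- A chamber on a minimal gallery from `c` to `d`, adjacent to `c`. -/
theorem exists_adjacent_toward {c d : X} (h : Δ.δ c d ≠ 1) : ∃ (i : B) (c' : X),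
    Δ.δ c c' = cs.simple i ∧ Δ.δ c d = cs.simple i * Δ.δ c' d ∧
      cs.length (Δ.δ c d) = cs.length (Δ.δ c' d) + 1 := by
  obtain ⟨i, hi⟩ := cs.exists_leftDescent_of_ne_one h
  obtain ⟨c', h1, h2⟩ := Δ.exists_δ c d i
  refine ⟨i, c', δ_simple_symm h1, by simp [h2], ?_⟩
  rw [h2]
  exact (cs.isLeftDescent_iff.1 hi).symm

theorem δ_mul_of_length {c d e : X}
    (h : cs.length (Δ.δ c d * Δ.δ d e) = cs.length (Δ.δ c d) + cs.length (Δ.δ d e)) :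
    Δ.δ c e = Δ.δ c d * Δ.δ d e := by
  induction hn : cs.length (Δ.δ c d) generalizing c with
  | zero =>
    rw [cs.length_eq_zero_iff] at hn
    rw [hn, (Δ.δ_eq_one_iff c d).1 hn, one_mul]
  | succ n ih =>
    have hne : Δ.δ c d ≠ 1 := fun h1 => by simp [h1] at hn
    obtain ⟨i, c', h1, h2, h3⟩ := Δ.exists_adjacent_toward hne
    rw [h3, h2, mul_assoc] at h
    have a1 := cs.length_mul_le (Δ.δ c' d) (Δ.δ d e)
    have a2 := cs.length_mul_le (cs.simple i) (Δ.δ c' d * Δ.δ d e)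
    rw [cs.length_simple] at a2
    have ih' := ih (c := c') (by omega) (by omega)
    rw [h2, mul_assoc, ← ih']
    apply Δ.δ_of_length _ _ _ _ h1
    rw [ih']
    omega

theorem δ_symm (c d : X) : Δ.δ d c = (Δ.δ c d)⁻¹ := by
  induction hn : cs.length (Δ.δ c d) generalizing c with
  | zero =>
    rw [cs.length_eq_zero_iff] at hn
    rw [hn, (Δ.δ_eq_one_iff c d).1 hn, δ_self, inv_one]
  | succ n ih =>
    have hne : Δ.δ c d ≠ 1 := fun h1 => by simp [h1] at hn
    obtain ⟨i, c', h1, h2, h3⟩ := Δ.exists_adjacent_toward hne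
    have ih' := ih c' (by omega)
    have h4 := δ_simple_symm h1
    rw [Δ.δ_mul_of_length (d := c'), ih', h4, h2]
    · simp
    · rw [ih', h4, cs.length_simple, cs.length_inv, ← h3, h2, ← cs.length_inv]
      simp

theorem length_δ_symm (c d : X) : cs.length (Δ.δ d c) = cs.length (Δ.δ c d) := by
  rw [δ_symm, cs.length_inv]

theorem length_δ_triangle (c d e : X) :
    cs.length (Δ.δ c e) ≤ cs.length (Δ.δ c d) + cs.length (Δ.δ d e) := by
  induction hn : cs.length (Δ.δ c d) generalizing c with
  | zero =>
    rw [cs.length_eq_zero_iff, Δ.δ_eq_one_iff] at hn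
    simp [hn]
  | succ n ih =>
    have hne : Δ.δ c d ≠ 1 := fun h1 => by simp [h1] at hn
    obtain ⟨i, c', h1, h2, h3⟩ := Δ.exists_adjacent_toward hne
    have ih' := ih c' (by omega)
    have := cs.length_mul_le (cs.simple i) (Δ.δ c' e)
    rw [cs.length_simple] at this
    rcases Δ.δ_eq_or c c' e i h1 with h | h <;> rw [h] <;> omega

theorem eq_or_δ_simple {c d e : X} {i : B} (h : Δ.δ c d = cs.simple i)
    (h' : Δ.δ c e = cs.simple i) : d = e ∨ Δ.δ d e = cs.simple i := by
  rcases Δ.δ_eq_or d c e i (δ_simple_symm h) with h1 | h1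
  · left
    rw [h'] at h1
    simpa [Δ.δ_eq_one_iff] using h1
  · exact Or.inr (h1.trans h')

theorem length_δ_le_one_iff {c d : X} :
    cs.length (Δ.δ c d) ≤ 1 ↔ c = d ∨ ∃ i, Δ.δ c d = cs.simple i := by
  rw [Nat.le_one_iff_eq_zero_or_eq_one, cs.length_eq_zero_iff, Δ.δ_eq_one_iff,
    cs.length_eq_one_iff]

/-! #### Spheres -/

theorem finite_sphere (hf : Δ.IsLocallyFinite) (c : X) (w : W) : {d : X | Δ.δ c d = w}.Finite := by
  induction hn : cs.length w generalizing c w with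
  | zero =>
    rw [cs.length_eq_zero_iff] at hn
    refine (Set.finite_singleton c).subset fun d hd => ?_
    rw [Set.mem_ofPred_eq, hn, Δ.δ_eq_one_iff] at hd
    exact hd.symm
  | succ n ih =>
    have hne : w ≠ 1 := fun h1 => by simp [h1] at hn
    obtain ⟨i, hi⟩ := cs.exists_leftDescent_of_ne_one hne
    rw [cs.isLeftDescent_iff] at hi
    refine ((hf.2 c i).biUnion fun x _ => ih x (cs.simple i * w) (by omega)).subset fun d hd => ?_
    obtain ⟨c', h1, h2⟩ := Δ.exists_δ c d i
    simp only [Set.mem_iUnion]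
    refine ⟨c', δ_simple_symm h1, ?_⟩
    rw [Set.mem_ofPred_eq] at hd ⊢
    rw [h2, hd]

theorem countable_coxeterGroup [Finite B] (cs : CoxeterSystem M W) : Countable W :=
  cs.wordProd_surjective.countable

theorem countable_of_isLocallyFinite (hf : Δ.IsLocallyFinite) : Countable X := by
  have := hf.1
  have : Countable W := countable_coxeterGroup cs
  obtain ⟨c⟩ := Δ.nonempty
  rw [← Set.countable_univ_iff]
  refine (Set.countable_iUnion fun w => (Δ.finite_sphere hf c w).countable).mono fun d _ => ?_
  exact Set.mem_iUnion.2 ⟨Δ.δ c d, rfl⟩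

theorem finite_ball (hf : Δ.IsLocallyFinite) (c : X) : {d : X | cs.length (Δ.δ c d) ≤ 1}.Finite := by
  have := hf.1
  refine ((Set.finite_singleton c).union
    (Set.finite_iUnion fun i => hf.2 c i)).subset fun d hd => ?_
  rcases Δ.length_δ_le_one_iff.1 hd with h | ⟨i, h⟩
  · exact Or.inl h.symm
  · exact Or.inr (Set.mem_iUnion.2 ⟨i, h⟩)

/-- A chamber `y` of the larger sphere is reached through exactly one chamber of the `i`-panel of
`c`: if two of them were at distance `w` from `y`, being `i`-adjacent would force one of these
distances to be `cs.simple i * w`. -/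
theorem card_sphere_simple_mul (hf : Δ.IsLocallyFinite)
    (hh : ∀ c c' w, Nat.card {x // Δ.δ c x = w} = Nat.card {x // Δ.δ c' x = w})
    (c : X) {w : W} {i : B} (hl : cs.length (cs.simple i * w) = cs.length w + 1) :
    Nat.card {x // Δ.δ c x = cs.simple i * w} =
      Nat.card {x // Δ.δ c x = cs.simple i} * Nat.card {x // Δ.δ c x = w} := by
  have : Finite {x // Δ.δ c x = cs.simple i} := (Δ.finite_sphere hf c _).to_subtype
  have (x : X) : Finite {y // Δ.δ x y = w} := (Δ.finite_sphere hf x _).to_subtype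
  have := Fintype.ofFinite {x // Δ.δ c x = cs.simple i}
  have hδ (x y : X) (hx : Δ.δ c x = cs.simple i) (hy : Δ.δ x y = w) :
      Δ.δ c y = cs.simple i * w := by
    rw [Δ.δ_of_length c x y i hx (by rw [hy, hl]), hy]
  let f : (Σ x : {x // Δ.δ c x = cs.simple i}, {y // Δ.δ x.1 y = w}) →
      {x // Δ.δ c x = cs.simple i * w} := fun z => ⟨z.2.1, hδ _ _ z.1.2 z.2.2⟩
  have hb : Function.Bijective f := by
    constructor
    · rintro ⟨⟨x, hx⟩, ⟨y, hy⟩⟩ ⟨⟨x', hx'⟩, ⟨y', hy'⟩⟩ h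
      simp only [f, Subtype.mk.injEq] at h
      subst h
      have : x = x' := by
        rcases Δ.eq_or_δ_simple hx hx' with h | h
        · exact h
        · have := Δ.δ_of_length x x' y i h (by rw [hy', hl])
          rw [hy, hy'] at this
          simp [← this] at hl
      subst this
      rfl
    · rintro ⟨y, hy⟩
      obtain ⟨x, h1, h2⟩ := Δ.exists_δ c y i
      exact ⟨⟨⟨x, δ_simple_symm h1⟩, ⟨y, by rw [h2, hy]; simp⟩⟩, rfl⟩
  rw [← Nat.card_eq_of_bijective f hb, Nat.card_sigma]
  simp [fun x => hh x c w]

theorem card_sphere_wordProd (hf : Δ.IsLocallyFinite)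
    (hh : ∀ c c' w, Nat.card {x // Δ.δ c x = w} = Nat.card {x // Δ.δ c' x = w})
    (c : X) {ω : List B} (hω : cs.IsReduced ω) :
    Nat.card {x // Δ.δ c x = cs.wordProd ω} =
      (ω.map fun i => Nat.card {x // Δ.δ c x = cs.simple i}).prod := by
  induction ω with
  | nil =>
    simp [Δ.δ_eq_one_iff]
  | cons i ω ih =>
    have h1 : cs.IsReduced ω := hω.drop 1
    have h2 := hω.eq
    rw [cs.wordProd_cons] at h2 ⊢
    rw [Δ.card_sphere_simple_mul hf hh c (by rw [h2, h1.eq]; rfl), ih h1]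
    simp

/-- The size of a sphere is a product over the letters of a reduced word, hence insensitive to
reversing the word. This is the source of unimodularity. -/
theorem card_sphere_inv (hf : Δ.IsLocallyFinite)
    (hh : ∀ c c' w, Nat.card {x // Δ.δ c x = w} = Nat.card {x // Δ.δ c' x = w})
    (c : X) (w : W) : Nat.card {x // Δ.δ c x = w⁻¹} = Nat.card {x // Δ.δ c x = w} := by
  obtain ⟨ω, h1, rfl⟩ := cs.exists_isReduced w
  rw [← cs.wordProd_reverse, Δ.card_sphere_wordProd hf hh c h1,
    Δ.card_sphere_wordProd hf hh c h1.reverse, List.map_reverse]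
  exact (List.reverse_perm _).prod_eq

/-! #### Strongly transitive actions -/

variable {Δ} {G : Type*} [Group G] [MulAction G X]

/-- Move an apartment through `c`, `d` to one through `c'`, `d'` with `c` going to `c'`; inside an
apartment a chamber is determined by its Weyl distance from `c'`. -/
theorem IsStronglyTransitive.exists_smul_eq (h : Δ.IsStronglyTransitive G) {c d c' d' : X}
    (hδ : Δ.δ c d = Δ.δ c' d') : ∃ g : G, g • c = c' ∧ g • d = d' := by
  obtain ⟨h1, 𝒜, ⟨h2, h3⟩, h4, h5⟩ := h
  obtain ⟨A, hA, hc, hd⟩ := h3 c d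
  obtain ⟨A', hA', hc', hd'⟩ := h3 c' d'
  obtain ⟨g, hg, hgA⟩ := h5 A hA A' hA' c hc c' hc'
  refine ⟨g, hg, ?_⟩
  have hgd : g • d ∈ A' := hgA ▸ ⟨d, hd, rfl⟩
  obtain ⟨α, hα, rfl⟩ := h2 A' hA'
  obtain ⟨u, rfl⟩ := hc'
  obtain ⟨v, rfl⟩ := hd'
  obtain ⟨v', hv'⟩ := hgd
  have : Δ.δ (g • c) (g • d) = Δ.δ (α u) (α v) := by rw [h1, hδ]
  rw [hg, ← hv', hα, hα, mul_right_inj] at this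
  rw [← hv', this]

theorem IsStronglyTransitive.isPretransitive (h : Δ.IsStronglyTransitive G) :
    MulAction.IsPretransitive G X :=
  ⟨fun c d => (h.exists_smul_eq (c := c) (d := c) (c' := d) (d' := d)
    (by simp [δ_self])).imp fun _ hg => hg.1⟩

theorem IsStronglyTransitive.card_sphere_eq (h : Δ.IsStronglyTransitive G) (c c' : X) (w : W) :
    Nat.card {x // Δ.δ c x = w} = Nat.card {x // Δ.δ c' x = w} := by
  have := h.isPretransitive
  obtain ⟨g, rfl⟩ := MulAction.exists_smul_eq G c c'
  refine Nat.card_congr ((MulAction.toPerm g).subtypeEquiv fun x => ?_)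
  simp [h.1]

theorem IsStronglyTransitive.orbit_stabilizer (h : Δ.IsStronglyTransitive G) (c d : X) :
    MulAction.orbit (MulAction.stabilizer G c) d = {x | Δ.δ c x = Δ.δ c d} := by
  ext x
  constructor
  · rintro ⟨g, rfl⟩
    have := h.1 g c d
    rwa [show (g : G) • c = c from g.2] at this
  · intro hx
    obtain ⟨g, h1, h2⟩ := h.exists_smul_eq (c := c) (d := d) (c' := c) (d' := x) hx.symm
    exact ⟨⟨g, h1⟩, h2⟩

theorem IsStronglyTransitive.card_orbit_stabilizer_comm (h : Δ.IsStronglyTransitive G)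
    (hf : Δ.IsLocallyFinite) (c d : X) :
    (MulAction.orbit (MulAction.stabilizer G c) d).ncard =
      (MulAction.orbit (MulAction.stabilizer G d) c).ncard := by
  rw [h.orbit_stabilizer, h.orbit_stabilizer, ← Nat.card_coe_set_eq, ← Nat.card_coe_set_eq,
    Δ.δ_symm c d]
  refine Eq.trans ?_ (Δ.card_sphere_inv hf h.card_sphere_eq d _).symm
  exact h.card_sphere_eq c d _

theorem IsStronglyTransitive.finite_orbit_stabilizer (h : Δ.IsStronglyTransitive G)
    (hf : Δ.IsLocallyFinite) (c d : X) :
    (MulAction.orbit (MulAction.stabilizer G c) d).Finite := by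
  rw [h.orbit_stabilizer]
  exact Δ.finite_sphere hf _ _

end Building

/-- `IsStepChain r n a b` holds when `b` is reached from `a` in `n` steps of the relation `r`. -/
inductive IsStepChain {α : Type*} (r : α → α → Prop) : ℕ → α → α → Prop
  | refl (a : α) : IsStepChain r 0 a a
  | tail {n : ℕ} {a b c : α} : IsStepChain r n a b → r b c → IsStepChain r (n + 1) a c

namespace IsStepChain

variable {α : Type*} {r : α → α → Prop}

theorem trans {m n : ℕ} {a b c : α} (h : IsStepChain r m a b) (h' : IsStepChain r n b c) :
    IsStepChain r (m + n) a c := by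
  induction h' with
  | refl => exact h
  | tail _ hr ih => exact (ih h).tail hr

theorem head {n : ℕ} {a b c : α} (h : r a b) (h' : IsStepChain r n b c) :
    IsStepChain r (n + 1) a c := by
  rw [add_comm]
  exact ((IsStepChain.refl a).tail h).trans h'

end IsStepChain

/-! ### Codistance and opposition -/

namespace Twinning

variable {B W : Type*} [Group W] {M : CoxeterMatrix B} {cs : CoxeterSystem M W}
  {Xp Xm : Type*} {Δp : Building cs Xp} {Δm : Building cs Xm} (τ : Twinning Δp Δm)

/-- The twinning with the two halves exchanged. -/
def swap : Twinning Δm Δp where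
  δs d c := (τ.δs c d)⁻¹
  pos_of_length d' d c i := τ.neg_of_length d' d c i
  pos_exists d c i := τ.neg_exists d c i
  neg_of_length c' c d i h := by simpa using τ.pos_of_length c' c d i h
  neg_exists c d i := by simpa using τ.pos_exists c d i

theorem swap_δs (d : Xm) (c : Xp) : τ.swap.δs d c = (τ.δs c d)⁻¹ := rfl

theorem swap_δs_eq_one_iff {d : Xm} {c : Xp} : τ.swap.δs d c = 1 ↔ τ.δs c d = 1 := by
  rw [swap_δs, inv_eq_one]

/-- If `cs.simple i` lengthens the codistance, some chamber `e` of the panel has the longer value,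
and every other chamber of the panel drops back from `e` to the value at `c`. -/
theorem δs_eq_or {c' c : Xp} {i : B} (h : Δp.δ c' c = cs.simple i) (d : Xm) :
    τ.δs c' d = cs.simple i * τ.δs c d ∨ τ.δs c' d = τ.δs c d := by
  rcases cs.length_simple_mul (τ.δs c d) i with hl | hl
  · obtain ⟨e, h1, h2⟩ := τ.pos_exists c d i
    rcases Δp.eq_or_δ_simple (Building.δ_simple_symm h) (Building.δ_simple_symm h1) with rfl | h3
    · exact Or.inl h2
    · right
      rw [τ.pos_of_length c' e d i h3 (by rw [h2]; simp [hl]), h2]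
      simp
  · exact Or.inl (τ.pos_of_length c' c d i h (by omega))

theorem δs_eq_or_of_opposite {c c' : Xp} {d : Xm} {i : B} (h : Δp.δ c c' = cs.simple i)
    (hd : τ.δs c d = 1) : τ.δs c' d = 1 ∨ τ.δs c' d = cs.simple i := by
  rcases τ.δs_eq_or (Building.δ_simple_symm h) d with h1 | h1
  · right; simpa [hd] using h1
  · left; rw [h1, hd]

theorem opposite_of_δs_eq_simple {c c' : Xp} {d : Xm} {i : B} (h : Δp.δ c c' = cs.simple i)
    (hd : τ.δs c d = cs.simple i) : τ.δs c' d = 1 := by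
  rw [τ.pos_of_length c' c d i (Building.δ_simple_symm h) (by simp [hd, cs.length_simple]), hd]
  simp

/-- In each panel there is a unique chamber that is not opposite to a given chamber opposite
to some chamber of the panel. -/
theorem eq_of_δs_eq_simple {c c' c'' : Xp} {d : Xm} {i : B}
    (h' : Δp.δ c c' = cs.simple i) (h'' : Δp.δ c c'' = cs.simple i)
    (hd' : τ.δs c' d = cs.simple i) (hd'' : τ.δs c'' d = cs.simple i) : c' = c'' := by
  rcases Δp.eq_or_δ_simple h' h'' with h | h
  · exact h
  · have := τ.opposite_of_δs_eq_simple h hd'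
    rw [hd''] at this
    simpa [this] using cs.length_simple i

theorem exists_opposite_adjacent {c c' : Xp} {d : Xm} {i : B} (h : Δp.δ c c' = cs.simple i)
    (hd : τ.δs c d = 1) : ∃ d', τ.δs c' d' = 1 ∧ (d = d' ∨ Δm.δ d d' = cs.simple i) := by
  rcases τ.δs_eq_or_of_opposite h hd with h1 | h1
  · exact ⟨d, h1, Or.inl rfl⟩
  · obtain ⟨d', h2, h3⟩ := τ.neg_exists d c' i
    refine ⟨d', ?_, Or.inr (Building.δ_simple_symm h2)⟩
    simpa [h1] using h3

theorem exists_opposite (d : Xm) : ∃ c, τ.δs c d = 1 := by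
  obtain ⟨c⟩ := Δp.nonempty
  induction hn : cs.length (τ.δs c d) generalizing c with
  | zero => exact ⟨c, cs.length_eq_zero_iff.1 hn⟩
  | succ n ih =>
    have hne : τ.δs c d ≠ 1 := fun h1 => by simp [h1] at hn
    obtain ⟨i, hi⟩ := cs.exists_leftDescent_of_ne_one hne
    rw [cs.isLeftDescent_iff] at hi
    obtain ⟨c', h1, h2⟩ := τ.pos_exists c d i
    exact ih c' (by rw [h2]; omega)

/-- Along a minimal gallery from `c` to `x`, the codistance to `d` shortens in step with the
distance to `x`. -/
theorem opposite_of_δ_eq_δs {c x : Xp} {d : Xm} (h : Δp.δ c x = τ.δs c d) : τ.δs x d = 1 := by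
  induction hn : cs.length (Δp.δ c x) generalizing c with
  | zero =>
    rw [cs.length_eq_zero_iff] at hn
    rw [← (Δp.δ_eq_one_iff c x).1 hn, ← h, hn]
  | succ n ih =>
    have hne : Δp.δ c x ≠ 1 := fun h1 => by simp [h1] at hn
    obtain ⟨i, c', h1, h2, h3⟩ := Δp.exists_adjacent_toward hne
    refine ih (c := c') ?_ (by omega)
    have h4 : cs.simple i * Δp.δ c x = Δp.δ c' x := by rw [h2]; simp
    rw [τ.pos_of_length c' c d i (Building.δ_simple_symm h1) (by rw [← h, h4]; omega), ← h, h4]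

/-! #### Chains of opposite pairs -/

/-- Two opposite pairs whose components are adjacent or equal. -/
def OppositeStep (p p' : Xp × Xm) : Prop :=
  (τ.δs p.1 p.2 = 1 ∧ τ.δs p'.1 p'.2 = 1) ∧
    cs.length (Δp.δ p.1 p'.1) ≤ 1 ∧ cs.length (Δm.δ p.2 p'.2) ≤ 1

/-- The positive component runs along a minimal gallery; the negative one crosses a panel of the
same type whenever opposition would be lost. -/
theorem exists_chain_following {c c' : Xp} {d : Xm} (hd : τ.δs c d = 1) :
    ∃ d', τ.δs c' d' = 1 ∧ cs.length (Δm.δ d d') ≤ cs.length (Δp.δ c c') ∧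
      IsStepChain τ.OppositeStep (cs.length (Δp.δ c c')) (c, d) (c', d') := by
  induction hn : cs.length (Δp.δ c c') generalizing c d with
  | zero =>
    rw [cs.length_eq_zero_iff, Δp.δ_eq_one_iff] at hn
    subst hn
    exact ⟨d, hd, by simp [Building.δ_self], .refl _⟩
  | succ n ih =>
    have hne : Δp.δ c c' ≠ 1 := fun h1 => by simp [h1] at hn
    obtain ⟨i, e, h1, h2, h3⟩ := Δp.exists_adjacent_toward hne
    obtain ⟨f, h4, h5⟩ := τ.exists_opposite_adjacent h1 hd
    have h6 : cs.length (Δm.δ d f) ≤ 1 :=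
      Δm.length_δ_le_one_iff.2 (h5.imp_right fun h => ⟨i, h⟩)
    obtain ⟨d', h7, h8, h9⟩ := ih h4 (by omega)
    refine ⟨d', h7, ?_, h9.head ⟨⟨hd, h4⟩, ?_, h6⟩⟩
    · have := Δm.length_δ_triangle d f d'
      omega
    · exact Δp.length_δ_le_one_iff.2 (Or.inr ⟨i, h1⟩)

/-- Now the negative component runs along a minimal gallery, and the positive one keeps its distance
from the anchor `c` equal to the codistance from `c`; this alone keeps the pair opposite. -/
theorem exists_chain_of_δ_eq_δs {c x : Xp} {d d' : Xm} (hx : Δp.δ c x = τ.δs c d) :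
    ∃ x', Δp.δ c x' = τ.δs c d' ∧
      IsStepChain τ.OppositeStep (cs.length (Δm.δ d d')) (x, d) (x', d') := by
  induction hn : cs.length (Δm.δ d d') generalizing x d with
  | zero =>
    rw [cs.length_eq_zero_iff, Δm.δ_eq_one_iff] at hn
    subst hn
    exact ⟨x, hx, .refl _⟩
  | succ n ih =>
    have hne : Δm.δ d d' ≠ 1 := fun h1 => by simp [h1] at hn
    obtain ⟨i, e, h1, h2, h3⟩ := Δm.exists_adjacent_toward hne
    have key : ∃ y, Δp.δ c y = τ.δs c e ∧ cs.length (Δp.δ x y) ≤ 1 := by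
      rcases τ.swap.δs_eq_or (Building.δ_simple_symm h1) c with h | h
      · obtain ⟨y, h4, h5⟩ := Δp.exists_δ x c i
        refine ⟨y, ?_, Δp.length_δ_le_one_iff.2 (Or.inr ⟨i, Building.δ_simple_symm h4⟩)⟩
        rw [Δp.δ_symm y c, h5, Δp.δ_symm c x, hx]
        rw [swap_δs, swap_δs] at h
        rw [← h, inv_inv]
      · rw [swap_δs, swap_δs, inv_inj] at h
        exact ⟨x, by rw [hx, h], by simp [Building.δ_self]⟩
    obtain ⟨y, h4, h5⟩ := key
    obtain ⟨x', h6, h7⟩ := ih h4 (by omega)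
    exact ⟨x', h6, h7.head ⟨⟨τ.opposite_of_δ_eq_δs hx, τ.opposite_of_δ_eq_δs h4⟩, h5,
      Δm.length_δ_le_one_iff.2 (Or.inr ⟨i, h1⟩)⟩⟩

/-- Opposite pairs are joined by chains of opposite pairs of length linear in the distance. -/
theorem exists_chain_opposite {c c' : Xp} {d d' : Xm} (h : τ.δs c d = 1) (h' : τ.δs c' d' = 1) :
    ∃ n ≤ 2 * (cs.length (Δp.δ c c') + cs.length (Δm.δ d d')),
      IsStepChain τ.OppositeStep n (c, d) (c', d') := by
  obtain ⟨e, h1, h2, h3⟩ := τ.exists_chain_following (c' := c') h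
  -- With anchor `c'`, opposite to both `e` and `d'`, the positive component leaves `c'` and returns
  -- to it.
  obtain ⟨x, h4, h5⟩ := τ.exists_chain_of_δ_eq_δs (c := c') (x := c') (d := e) (d' := d')
    (by rw [h1, Δp.δ_self])
  rw [h', Δp.δ_eq_one_iff] at h4
  subst h4
  refine ⟨_, ?_, h3.trans h5⟩
  have := Δm.length_δ_triangle e d d'
  have := Δm.length_δ_symm d e
  omega

/-! #### Rigidity -/

/-- `x` lies in the residue of type `I` of `c`. -/
def _root_.Building.InResidue {X : Type*} (Δ : Building cs X) (I : Set B) : X → X → Prop :=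
  Relation.ReflTransGen fun a b => ∃ i ∈ I, Δ.δ a b = cs.simple i

/-- The automorphism `φ` fixes `c` and all the neighbours of the chambers in the residue of
type `I` of `c`. -/
def _root_.Building.FixesAround {X : Type*} (Δ : Building cs X) (I : Set B) (φ : X → X) (c : X) :
    Prop :=
  ∀ x, Δ.InResidue I c x → φ x = x ∧ ∀ y i, Δ.δ x y = cs.simple i → φ y = y

theorem _root_.Building.FixesAround.of_inResidue {X : Type*} {Δ : Building cs X} {I : Set B}
    {φ : X → X} {c x : X} (h : Δ.FixesAround I φ c) (hx : Δ.InResidue I c x) :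
    Δ.FixesAround I φ x :=
  fun y hy => h y (hx.trans hy)

/-- A pair of maps preserving the Weyl distances and the codistance. -/
structure IsAut (φ : Xp → Xp) (ψ : Xm → Xm) : Prop where
  δ_pos : ∀ c d, Δp.δ (φ c) (φ d) = Δp.δ c d
  δ_neg : ∀ c d, Δm.δ (ψ c) (ψ d) = Δm.δ c d
  δs : ∀ c d, τ.δs (φ c) (ψ d) = τ.δs c d

variable {τ} {φ : Xp → Xp} {ψ : Xm → Xm}

theorem IsAut.swap (h : τ.IsAut φ ψ) : τ.swap.IsAut ψ φ :=
  ⟨h.δ_neg, h.δ_pos, fun d c => by rw [swap_δs, swap_δs, h.δs]⟩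

/-- Some fixed chamber `e` in the `i`-panel of `c` is not opposite to `y`, and `y` is the only such
chamber in its panel, so it is fixed too. -/
theorem IsAut.fixes_adjacent (h : τ.IsAut φ ψ) {c : Xp} {d y : Xm} {i : B} (hcd : τ.δs c d = 1)
    (hc : φ c = c) (hc' : ∀ y, Δp.δ c y = cs.simple i → φ y = y) (hd : ψ d = d)
    (hy : Δm.δ d y = cs.simple i) : ψ y = y := by
  have key : ∃ e, φ e = e ∧ τ.δs e y = cs.simple i := by
    rcases τ.swap.δs_eq_or_of_opposite hy (τ.swap_δs_eq_one_iff.2 hcd) with h1 | h1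
    · rw [swap_δs_eq_one_iff] at h1
      obtain ⟨e, h2, h3⟩ := τ.pos_exists c y i
      exact ⟨e, hc' e (Building.δ_simple_symm h2), by simpa [h1] using h3⟩
    · refine ⟨c, hc, ?_⟩
      rw [swap_δs, inv_eq_iff_eq_inv] at h1
      simpa using h1
  obtain ⟨e, h1, h2⟩ := key
  have h3 := h.δs e y
  have h4 := h.δ_neg d y
  rw [h1, h2] at h3
  rw [hd, hy] at h4
  exact τ.swap.eq_of_δs_eq_simple h4 hy (by rw [swap_δs, h3]; simp) (by rw [swap_δs, h2]; simp)

theorem IsAut.fixesAround_opposite (h : τ.IsAut φ ψ) {I : Set B} {c : Xp} {d : Xm}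
    (hcd : τ.δs c d = 1) (hc : Δp.FixesAround I φ c) (hd : ψ d = d) : Δm.FixesAround I ψ d := by
  have key : ∀ x, Δm.InResidue I d x → ψ x = x ∧ ∃ c', Δp.InResidue I c c' ∧ τ.δs c' x = 1 := by
    intro x hx
    induction hx with
    | refl => exact ⟨hd, c, .refl, hcd⟩
    | @tail x y _ hxy ih =>
      obtain ⟨i, hi, hxy⟩ := hxy
      obtain ⟨h1, c', h2, h3⟩ := ih
      refine ⟨h.fixes_adjacent h3 (hc c' h2).1 (fun y => (hc c' h2).2 y i) h1 hxy, ?_⟩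
      obtain ⟨c'', h4, h5⟩ := τ.swap.exists_opposite_adjacent hxy (τ.swap_δs_eq_one_iff.2 h3)
      rw [swap_δs_eq_one_iff] at h4
      rcases h5 with rfl | h5
      · exact ⟨c', h2, h4⟩
      · exact ⟨c'', h2.tail ⟨i, hi, h5⟩, h4⟩
  intro x hx
  obtain ⟨h1, c', h2, h3⟩ := key x hx
  exact ⟨h1, fun y i hy => h.fixes_adjacent h3 (hc c' h2).1 (fun y => (hc c' h2).2 y i) h1 hy⟩

theorem IsAut.fixesAround_adjacent (h : τ.IsAut φ ψ) {I : Set B}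
    (hI : ∀ j ∉ I, ∀ a b : Xp, Δp.δ a b = cs.simple j → ∃ e ≠ b, Δp.δ a e = cs.simple j)
    {c c' : Xp} {d : Xm} (hcd : τ.δs c d = 1) (hc : Δp.FixesAround I φ c) (hd : ψ d = d)
    {j : B} (hj : Δp.δ c c' = cs.simple j) :
    Δp.FixesAround I φ c' ∧ ∃ d', ψ d' = d' ∧ τ.δs c' d' = 1 := by
  have hcc := hc c .refl
  by_cases hjI : j ∈ I
  · refine ⟨hc.of_inResidue (.single ⟨j, hjI, hj⟩), ?_⟩
    obtain ⟨d', h1, h2⟩ := τ.exists_opposite_adjacent hj hcd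
    refine ⟨d', ?_, h1⟩
    rcases h2 with rfl | h2
    · exact hd
    · exact h.fixes_adjacent hcd hcc.1 (fun y => hcc.2 y j) hd h2
  -- To cross a panel of type outside `I`, pass to a fixed `d'` opposite to both `c` and `c'`, and
  -- back. If `d` fails, a third chamber `e` of the panel provides `d'`: choose it in the panel of
  -- `d` so that `e` is the one chamber not opposite to it.
  · have key : ∃ d', ψ d' = d' ∧ τ.δs c d' = 1 ∧ τ.δs c' d' = 1 := by
      rcases τ.δs_eq_or_of_opposite hj hcd with h1 | h1
      · exact ⟨d, hd, hcd, h1⟩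
      · obtain ⟨e, h2, h3⟩ := hI j hjI c c' hj
        have h4 : Δp.δ c' e = cs.simple j :=
          (Δp.eq_or_δ_simple hj h3).resolve_left fun h => h2 h.symm
        have h5 : τ.δs e d = 1 := τ.opposite_of_δs_eq_simple h4 h1
        obtain ⟨d', h6, h7⟩ := τ.neg_exists d e j
        rw [h5, inv_one, mul_one, inv_eq_iff_eq_inv, CoxeterSystem.inv_simple] at h7
        exact ⟨d', h.fixes_adjacent hcd hcc.1 (fun y => hcc.2 y j) hd (Building.δ_simple_symm h6),
          τ.opposite_of_δs_eq_simple (Building.δ_simple_symm h3) h7,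
          τ.opposite_of_δs_eq_simple (Building.δ_simple_symm h4) h7⟩
    obtain ⟨d', h1, h2, h3⟩ := key
    exact ⟨h.swap.fixesAround_opposite (τ.swap_δs_eq_one_iff.2 h3)
      (h.fixesAround_opposite h2 hc h1) (hcc.2 c' j hj), d', h1, h3⟩

/-- Rigidity: an automorphism of a twin building which fixes a chamber `d` and fixes everything
around an opposite chamber is trivial. -/
theorem IsAut.eq_id (h : τ.IsAut φ ψ) {I : Set B}
    (hI : ∀ j ∉ I, ∀ a b : Xp, Δp.δ a b = cs.simple j → ∃ e ≠ b, Δp.δ a e = cs.simple j)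
    {c : Xp} {d : Xm} (hcd : τ.δs c d = 1) (hc : Δp.FixesAround I φ c) (hd : ψ d = d) :
    (∀ x, φ x = x) ∧ ∀ y, ψ y = y := by
  have hφ : ∀ x, Δp.FixesAround I φ x := by
    intro x
    induction hn : cs.length (Δp.δ c x) generalizing c d with
    | zero =>
      rw [cs.length_eq_zero_iff, Δp.δ_eq_one_iff] at hn
      exact hn ▸ hc
    | succ n ih =>
      have hne : Δp.δ c x ≠ 1 := fun h1 => by simp [h1] at hn
      obtain ⟨i, e, h1, h2, h3⟩ := Δp.exists_adjacent_toward hne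
      obtain ⟨h4, d', h5, h6⟩ := h.fixesAround_adjacent hI hcd hc hd h1
      exact ih h6 h4 h5 (by omega)
  refine ⟨fun x => (hφ x x .refl).1, fun y => ?_⟩
  induction hn : cs.length (Δm.δ d y) generalizing c d with
  | zero =>
    rw [cs.length_eq_zero_iff, Δm.δ_eq_one_iff] at hn
    exact hn ▸ hd
  | succ n ih =>
    have hne : Δm.δ d y ≠ 1 := fun h1 => by simp [h1] at hn
    obtain ⟨i, e, h1, h2, h3⟩ := Δm.exists_adjacent_toward hne
    obtain ⟨c', h4⟩ := τ.exists_opposite e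
    exact ih h4 (hφ c') (h.fixes_adjacent hcd (hφ c c .refl).1
      (fun y hy => (hφ c c .refl).2 y i hy) hd h1) (by omega)

end Twinning

/-! ### Orbits of a lattice -/

section Lattice

open MeasureTheory Pointwise

theorem measure_smul_set_of_invariant {G : Type*} [Group G] {Γ : Subgroup G}
    [MeasurableSpace (G ⧸ Γ)] {μ : Measure (G ⧸ Γ)}
    (hμ : ∀ (g : G) (E : Set (G ⧸ Γ)), MeasurableSet E → μ ((fun x => g • x) ⁻¹' E) = μ E)
    (g : G) {E : Set (G ⧸ Γ)} (hE : MeasurableSet E) : μ (g • E) = μ E := by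
  rw [← hμ g⁻¹ E hE]
  congr 1
  ext x
  simp [Set.mem_smul_set_iff_inv_smul_mem]

variable {G Y : Type*} [Group G] [TopologicalSpace G] [IsTopologicalGroup G] [MulAction G Y]
  {Γ : Subgroup G}

theorem isOpen_setOf_inv_smul_mem {y : Y}
    (ho : IsOpen (MulAction.stabilizer G y : Set G)) (T : Set Y) : IsOpen {h : G | h⁻¹ • y ∈ T} := by
  rw [isOpen_iff_forall_mem_open]
  intro h hh
  refine ⟨{k | k * h⁻¹ ∈ MulAction.stabilizer G y}, fun k hk => ?_,
    ho.preimage (continuous_mul_const h⁻¹), by simp⟩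
  have h1 : (k * h⁻¹)⁻¹ • y = y := by
    rw [inv_smul_eq_iff]
    exact (MulAction.mem_stabilizer_iff.1 hk).symm
  have h2 : k⁻¹ • y = h⁻¹ • y := by
    conv_rhs => rw [← h1]
    simp [mul_smul]
  change k⁻¹ • y ∈ T
  rw [h2]
  exact hh

/-- The image in `G ⧸ Γ` of the stabilizer of `y`. -/
def stabilizerImage (Γ : Subgroup G) (y : Y) : Set (G ⧸ Γ) :=
  (QuotientGroup.mk : G → G ⧸ Γ) '' (MulAction.stabilizer G y : Set G)

section Measure

variable [MeasurableSpace (G ⧸ Γ)] [BorelSpace (G ⧸ Γ)] {μ : Measure (G ⧸ Γ)}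

theorem measurableSet_coe_image {V : Set G} (hV : IsOpen V) :
    MeasurableSet ((QuotientGroup.mk : G → G ⧸ Γ) '' V) :=
  (QuotientGroup.isOpenMap_coe V hV).measurableSet

theorem measurableSet_smul_coe_image {V : Set G} (hV : IsOpen V) (g : G) :
    MeasurableSet (g • (QuotientGroup.mk : G → G ⧸ Γ) '' V) := by
  have : g • (QuotientGroup.mk : G → G ⧸ Γ) '' V = (QuotientGroup.mk : G → G ⧸ Γ) '' (g • V) := by
    rw [← Set.image_smul, ← Set.image_smul, Set.image_image, Set.image_image]
    rfl
  rw [this]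
  exact measurableSet_coe_image (hV.smul g)

theorem measurableSet_stabilizerImage {y : Y}
    (ho : IsOpen (MulAction.stabilizer G y : Set G)) : MeasurableSet (stabilizerImage Γ y) :=
  measurableSet_coe_image ho

/-- The stabilizer of `q` is a union of translates of its intersection with that of `p`, one for
each point of the orbit. -/
theorem measure_stabilizerImage_le
    (hμ : ∀ (g : G) (E : Set (G ⧸ Γ)), MeasurableSet E → μ ((fun x => g • x) ⁻¹' E) = μ E)
    (ho : ∀ y : Y, IsOpen (MulAction.stabilizer G y : Set G)) (p q : Y)
    (hf : (MulAction.orbit (MulAction.stabilizer G q) p).Finite) :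
    μ (stabilizerImage Γ q) ≤ (MulAction.orbit (MulAction.stabilizer G q) p).ncard *
      μ ((QuotientGroup.mk : G → G ⧸ Γ) ''
        ((MulAction.stabilizer G p : Set G) ∩ MulAction.stabilizer G q)) := by
  set V : Set G := (MulAction.stabilizer G p : Set G) ∩ MulAction.stabilizer G q with hVdef
  have hV : IsOpen V := (ho p).inter (ho q)
  have hu : ∀ x : Y, ∃ u : G, x ∈ MulAction.orbit (MulAction.stabilizer G q) p →
      u • q = q ∧ u • p = x := by
    intro x
    by_cases hx : x ∈ MulAction.orbit (MulAction.stabilizer G q) p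
    · obtain ⟨u, rfl⟩ := hx
      exact ⟨u, fun _ => ⟨u.2, rfl⟩⟩
    · exact ⟨1, fun h => absurd h hx⟩
  choose u hu using hu
  have hsub : stabilizerImage Γ q ⊆
      ⋃ x ∈ hf.toFinset, u x • (QuotientGroup.mk : G → G ⧸ Γ) '' V := by
    rintro _ ⟨h, hh, rfl⟩
    have hx : h • p ∈ MulAction.orbit (MulAction.stabilizer G q) p := ⟨⟨h, hh⟩, rfl⟩
    obtain ⟨h1, h2⟩ := hu _ hx
    have hh' : h • q = q := hh
    simp only [Set.mem_iUnion]
    refine ⟨h • p, hf.mem_toFinset.2 hx, ?_⟩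
    rw [Set.mem_smul_set_iff_inv_smul_mem]
    refine ⟨(u (h • p))⁻¹ * h, ⟨?_, ?_⟩, rfl⟩
    · change ((u (h • p))⁻¹ * h) • p = p
      rw [mul_smul, inv_smul_eq_iff, h2]
    · change ((u (h • p))⁻¹ * h) • q = q
      rw [mul_smul, inv_smul_eq_iff, h1, hh']
  refine (measure_mono hsub).trans ((measure_biUnion_finset_le _ _).trans ?_)
  simp_rw [measure_smul_set_of_invariant hμ _ (measurableSet_coe_image hV)]
  rw [Finset.sum_const, nsmul_eq_mul, Set.ncard_eq_toFinset_card _ hf]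

theorem le_measure_stabilizerImage
    (hμ : ∀ (g : G) (E : Set (G ⧸ Γ)), MeasurableSet E → μ ((fun x => g • x) ⁻¹' E) = μ E)
    (ho : ∀ y : Y, IsOpen (MulAction.stabilizer G y : Set G)) (p q : Y)
    (hf : (MulAction.orbit (MulAction.stabilizer G p) q).Finite) {K : ℕ}
    (hfin : {γ | γ ∈ Γ ∧ γ • p = p}.Finite) (hK : {γ | γ ∈ Γ ∧ γ • p = p}.ncard ≤ K) :
    (MulAction.orbit (MulAction.stabilizer G p) q).ncard *
      μ ((QuotientGroup.mk : G → G ⧸ Γ) ''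
        ((MulAction.stabilizer G p : Set G) ∩ MulAction.stabilizer G q)) ≤
      K * μ (stabilizerImage Γ p) := by
  classical
  set V : Set G := (MulAction.stabilizer G p : Set G) ∩ MulAction.stabilizer G q with hVdef
  have hV : IsOpen V := (ho p).inter (ho q)
  have hu : ∀ x : Y, ∃ u : G, x ∈ MulAction.orbit (MulAction.stabilizer G p) q →
      u • p = p ∧ u • q = x := by
    intro x
    by_cases hx : x ∈ MulAction.orbit (MulAction.stabilizer G p) q
    · obtain ⟨u, rfl⟩ := hx
      exact ⟨u, fun _ => ⟨u.2, rfl⟩⟩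
    · exact ⟨1, fun h => absurd h hx⟩
  choose u hu using hu
  let A : Y → Set (G ⧸ Γ) := fun x => u x • (QuotientGroup.mk : G → G ⧸ Γ) '' V
  have hA : ∀ x, MeasurableSet (A x) := fun x => measurableSet_smul_coe_image hV _
  have hE : MeasurableSet (stabilizerImage Γ p) := measurableSet_coe_image (ho p)
  have hmem : ∀ x ∈ hf.toFinset, ∀ z ∈ A x, ∃ h : G,
      h • p = p ∧ h • q = x ∧ (h : G ⧸ Γ) = z := by
    intro x hx z hz
    obtain ⟨h1, h2⟩ := hu x (hf.mem_toFinset.1 hx)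
    obtain ⟨_, ⟨v, ⟨hvp, hvq⟩, rfl⟩, rfl⟩ := hz
    have hvp : v • p = p := hvp
    have hvq : v • q = q := hvq
    exact ⟨u x * v, by rw [mul_smul, hvp, h1], by rw [mul_smul, hvq, h2], rfl⟩
  -- The translates overlap at most `K` times: those through the coset of `h₁` are indexed by points
  -- `(h₁ * γ) • q` with `γ ∈ Γ` fixing `p`.
  have hpt : ∀ z, ∑ x ∈ hf.toFinset, (A x).indicator 1 z ≤
      (stabilizerImage Γ p).indicator (fun _ => (K : ENNReal)) z := by
    intro z
    by_cases hz : z ∈ stabilizerImage Γ p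
    · rw [Set.indicator_of_mem hz]
      obtain ⟨h₁, hh₁, rfl⟩ := hz
      have hh₁ : h₁ • p = p := hh₁
      simp only [Set.indicator_apply, Pi.one_apply]
      rw [Finset.sum_boole]
      norm_cast
      refine le_trans (le_trans (Finset.card_le_card (t := hfin.toFinset.image
        fun γ => (h₁ * γ) • q) ?_) Finset.card_image_le) ?_
      · intro x hx
        rw [Finset.mem_filter] at hx
        obtain ⟨h, h2, h3, h4⟩ := hmem x hx.1 _ hx.2
        refine Finset.mem_image.2 ⟨h₁⁻¹ * h, hfin.mem_toFinset.2 ⟨?_, ?_⟩, ?_⟩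
        · exact QuotientGroup.eq.1 h4.symm
        · rw [mul_smul, h2, inv_smul_eq_iff, hh₁]
        · simpa using h3
      · rwa [← Set.ncard_eq_toFinset_card _ hfin]
    · rw [Set.indicator_of_notMem hz, nonpos_iff_eq_zero]
      refine Finset.sum_eq_zero fun x hx => Set.indicator_of_notMem (fun hzA => hz ?_) _
      obtain ⟨h, h2, -, h4⟩ := hmem x hx z hzA
      exact ⟨h, h2, h4⟩
  calc _ = ∑ x ∈ hf.toFinset, μ (A x) := by
        simp_rw [A, measure_smul_set_of_invariant hμ _ (measurableSet_coe_image hV)]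
        rw [Finset.sum_const, nsmul_eq_mul, Set.ncard_eq_toFinset_card _ hf]
    _ = ∫⁻ z, ∑ x ∈ hf.toFinset, (A x).indicator 1 z ∂μ := by
        rw [lintegral_finsetSum _ fun x _ => measurable_one.indicator (hA x)]
        exact Finset.sum_congr rfl fun x _ => (lintegral_indicator_one (hA x)).symm
    _ ≤ ∫⁻ z, (stabilizerImage Γ p).indicator (fun _ => (K : ENNReal)) z ∂μ := lintegral_mono hpt
    _ = _ := lintegral_indicator_const hE _

theorem measure_stabilizerImage_pos [Countable Y]
    [MulAction.IsPretransitive G Y]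
    (hμ : ∀ (g : G) (E : Set (G ⧸ Γ)), MeasurableSet E → μ ((fun x => g • x) ⁻¹' E) = μ E)
    (h0 : μ ≠ 0) (ho : ∀ y : Y, IsOpen (MulAction.stabilizer G y : Set G)) (p : Y) :
    μ (stabilizerImage Γ p) ≠ 0 := by
  intro hz
  apply h0
  choose g hg using fun y : Y => MulAction.exists_smul_eq G p y
  rw [← Measure.measure_univ_eq_zero]
  refine measure_mono_null (t := ⋃ y : Y, g y • stabilizerImage Γ p) (fun z _ => ?_)
    (measure_iUnion_null fun y => ?_)
  · obtain ⟨h, rfl⟩ := QuotientGroup.mk_surjective z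
    refine Set.mem_iUnion.2 ⟨h • p, ?_⟩
    rw [Set.mem_smul_set_iff_inv_smul_mem]
    refine ⟨(g (h • p))⁻¹ * h, ?_, rfl⟩
    change ((g (h • p))⁻¹ * h) • p = p
    rw [mul_smul, inv_smul_eq_iff, hg]
  · rw [measure_smul_set_of_invariant hμ _ (measurableSet_stabilizerImage (ho p)), hz]

end Measure

/-- A lattice has finitely many orbits of points with stabilizers of bounded order, in a countable
set on which the ambient group acts transitively, with open stabilizers, in a unimodular way. -/
theorem Subgroup.IsLatticeIn.exists_finite_representatives [Countable Y]
    [MulAction.IsPretransitive G Y] (hΓ : Γ.IsLatticeIn)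
    (ho : ∀ y : Y, IsOpen (MulAction.stabilizer G y : Set G))
    (hf : ∀ p q : Y, (MulAction.orbit (MulAction.stabilizer G p) q).Finite)
    (hc : ∀ p q : Y, (MulAction.orbit (MulAction.stabilizer G p) q).ncard =
      (MulAction.orbit (MulAction.stabilizer G q) p).ncard)
    {K : ℕ} {Q : Set Y} (hQ : ∀ p ∈ Q, {γ | γ ∈ Γ ∧ γ • p = p}.Finite ∧
      {γ | γ ∈ Γ ∧ γ • p = p}.ncard ≤ K) :
    ∃ R ⊆ Q, R.Finite ∧ ∀ p ∈ Q, ∃ r ∈ R, ∃ γ ∈ Γ, γ • r = p := by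
  let _ : MeasurableSpace (G ⧸ Γ) := borel _
  have : BorelSpace (G ⧸ Γ) := ⟨rfl⟩
  obtain ⟨-, μ, h0, htop, hμ⟩ := hΓ
  rcases Q.eq_empty_or_nonempty with rfl | ⟨p₀, -⟩
  · exact ⟨∅, subset_rfl, Set.finite_empty, by simp⟩
  let cl : Y → Quotient (MulAction.orbitRel Γ Y) := Quotient.mk _
  have hcl : ∀ (γ : Γ) y, cl ((γ : G) • y) = cl y := fun γ y => Quotient.sound ⟨γ, rfl⟩
  -- `G ⧸ Γ` is cut into disjoint pieces, one per `Γ`-orbit. Those of orbits meeting `Q` have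
  -- measure bounded below, so finite total measure leaves only finitely many.
  let A : Quotient (MulAction.orbitRel Γ Y) → Set (G ⧸ Γ) := fun ω =>
    QuotientGroup.mk '' {h : G | h⁻¹ • p₀ ∈ cl ⁻¹' {ω}}
  have hA : ∀ ω, MeasurableSet (A ω) := fun ω =>
    measurableSet_coe_image (isOpen_setOf_inv_smul_mem (ho p₀) _)
  have hdisj : Pairwise (Function.onFun Disjoint A) := by
    intro ω ω' hne
    refine Set.disjoint_left.2 ?_
    rintro _ ⟨h, h1, rfl⟩ ⟨h', h1', h2⟩
    apply hne
    have h1 : cl (h⁻¹ • p₀) = ω := h1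
    have h1' : cl (h'⁻¹ • p₀) = ω' := h1'
    have := hcl ⟨_, QuotientGroup.eq.1 h2⟩ (h⁻¹ • p₀)
    rw [← h1, ← h1', ← this]
    simp [mul_smul]
  have hle : ∀ p ∈ Q, μ (stabilizerImage Γ p₀) ≤ K * μ (A (cl p)) := by
    intro p hp
    obtain ⟨g, hg⟩ := MulAction.exists_smul_eq G p p₀
    calc _ ≤ _ := measure_stabilizerImage_le hμ ho p p₀ (hf _ _)
      _ ≤ K * μ (stabilizerImage Γ p) := by
        -- Unimodularity exchanges the two orbit counts, so that the upper and lower estimates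
        -- involve the same quantity.
        rw [← hc]
        exact le_measure_stabilizerImage hμ ho p p₀ (hf _ _) (hQ p hp).1 (hQ p hp).2
      _ = K * μ (g • stabilizerImage Γ p) := by
        rw [measure_smul_set_of_invariant hμ _ (measurableSet_stabilizerImage (ho p))]
      _ ≤ _ := by
        gcongr
        rintro _ ⟨_, ⟨h, hh, rfl⟩, rfl⟩
        have hh : h • p = p := hh
        refine ⟨g * h, ?_, rfl⟩
        have : (g * h)⁻¹ • p₀ = p := by rw [inv_smul_eq_iff, mul_smul, hh, hg]
        change cl ((g * h)⁻¹ • p₀) = cl p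
        rw [this]
  have hfin := Measure.finite_const_le_meas_of_disjoint_iUnion μ
    (ε := μ (stabilizerImage Γ p₀) / K)
    (ENNReal.div_pos (measure_stabilizerImage_pos hμ h0 ho p₀) (ENNReal.natCast_ne_top K))
    hA hdisj (ne_top_of_le_ne_top htop (measure_mono (Set.subset_univ _)))
  obtain ⟨R, hR, hb⟩ := Set.SurjOn.exists_bijOn_subset (Set.surjOn_image cl Q)
  have hfinQ : (cl '' Q).Finite := by
    refine hfin.subset ?_
    rintro _ ⟨p, hp, rfl⟩
    exact ENNReal.div_le_of_le_mul' (hle p hp)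
  refine ⟨R, hR, hb.finite_iff_finite.2 hfinQ, fun p hp => ?_⟩
  obtain ⟨r, hr, hrp⟩ := hb.surjOn ⟨p, hp, rfl⟩
  obtain ⟨γ, hγ⟩ := Quotient.exact hrp.symm
  exact ⟨r, hr, γ, γ.2, hγ⟩

end Lattice

/-! ### Word lengths -/

section WordLength

variable {G : Type*} [Group G] {S : Set G}

theorem wordLength_le_length {l : List G} (h : ∀ x ∈ l, x ∈ S ∨ x⁻¹ ∈ S) :
    wordLength S l.prod ≤ l.length :=
  Nat.sInf_le ⟨l, h, rfl, rfl⟩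

theorem IsGenerating.exists_list (hS : IsGenerating S) (g : G) :
    ∃ l : List G, (∀ x ∈ l, x ∈ S ∨ x⁻¹ ∈ S) ∧ l.prod = g ∧ l.length = wordLength S g := by
  have hg : g ∈ Subgroup.closure S := by
    rw [show Subgroup.closure S = ⊤ from hS]
    trivial
  rw [← Subgroup.mem_toSubmonoid, Subgroup.closure_toSubmonoid] at hg
  obtain ⟨l, h1, h2⟩ := Submonoid.exists_list_of_mem_closure hg
  exact Nat.sInf_mem (s := {n : ℕ | ∃ l : List G, (∀ x ∈ l, x ∈ S ∨ x⁻¹ ∈ S) ∧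
    l.prod = g ∧ l.length = n}) ⟨_, l, h1, h2, rfl⟩

theorem wordLength_one : wordLength S (1 : G) = 0 := by
  simpa using wordLength_le_length (S := S) (l := []) (by simp)

theorem IsGenerating.wordLength_mul_le (hS : IsGenerating S) (g h : G) :
    wordLength S (g * h) ≤ wordLength S g + wordLength S h := by
  obtain ⟨l, h1, h2, h3⟩ := hS.exists_list g
  obtain ⟨l', h1', h2', h3'⟩ := hS.exists_list h
  have := wordLength_le_length (S := S) (l := l ++ l')
    (by simpa [or_imp, forall_and] using ⟨h1, h1'⟩)
  rwa [List.prod_append, h2, h2', List.length_append, h3, h3'] at this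

theorem IsGenerating.wordLength_inv_le (hS : IsGenerating S) (g : G) :
    wordLength S g⁻¹ ≤ wordLength S g := by
  obtain ⟨l, h1, h2, h3⟩ := hS.exists_list g
  have := wordLength_le_length (S := S) (l := (l.map fun x => x⁻¹).reverse) (by
    intro x hx
    simp only [List.mem_reverse, List.mem_map] at hx
    obtain ⟨y, hy, rfl⟩ := hx
    simpa using (h1 y hy).symm)
  rwa [← List.prod_inv_reverse, h2, List.length_reverse, List.length_map, h3] at this

theorem apply_list_prod_le {f : G → ℕ} (h1 : f 1 = 0) (hmul : ∀ g h, f (g * h) ≤ f g + f h) {K : ℕ}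
    {l : List G} (hl : ∀ x ∈ l, f x ≤ K) : f l.prod ≤ K * l.length := by
  induction l with
  | nil => simp [h1]
  | cons a l ih =>
    rw [List.forall_mem_cons] at hl
    have := ih hl.2
    have := hmul a l.prod
    rw [List.prod_cons, List.length_cons, mul_add]
    omega

/-- Applied to the word length on `G` restricted to `Γ`, and to the displacement of a base pair. -/
theorem IsGenerating.apply_le_mul_wordLength (hS : IsGenerating S) {f : G → ℕ} (h1 : f 1 = 0)
    (hmul : ∀ g h, f (g * h) ≤ f g + f h) (hinv : ∀ g, f g⁻¹ ≤ f g) {K : ℕ}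
    (hK : ∀ x ∈ S, f x ≤ K) (g : G) : f g ≤ K * wordLength S g := by
  obtain ⟨l, h2, rfl, h3⟩ := hS.exists_list g
  rw [← h3]
  refine apply_list_prod_le h1 hmul fun x hx => ?_
  rcases h2 x hx with h | h
  · exact hK x h
  · exact (inv_inv x ▸ hinv x⁻¹).trans (hK _ h)

theorem Set.Finite.exists_nat_bound {α : Type*} {s : Set α} (hs : s.Finite) (f : α → ℕ) :
    ∃ K, ∀ x ∈ s, f x ≤ K := by
  obtain ⟨K, hK⟩ := (hs.image f).bddAbove
  exact ⟨K, fun x hx => hK ⟨x, hx, rfl⟩⟩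

/-- If the group acts with finite stabilizers and the targets of the steps of a locally finite
invariant relation `r` lie in finitely many orbits, then the elements joined to the identity by
chains of `r` are products of elements of a finite set, of length controlled by the chain. -/
theorem exists_finite_list_of_isStepChain {Y : Type*} [MulAction G Y] {r : Y → Y → Prop}
    (hr : ∀ (g : G) a b, r a b → r (g • a) (g • b))
    (hlf : ∀ a, {b | r a b}.Finite) (hst : ∀ b : Y, {g : G | g • b = b}.Finite)
    {R : Set Y} (hR : R.Finite) (hRr : ∀ y ∈ R, r y y)
    (hcov : ∀ a b, r a b → ∃ y ∈ R, ∃ g : G, g • y = b) {o : Y} (ho : o ∈ R) :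
    ∃ T : Set G, T.Finite ∧ ∀ (n : ℕ) (g : G), IsStepChain r n o (g • o) →
      ∃ l : List G, (∀ x ∈ l, x ∈ T) ∧ l.prod = g ∧ l.length = n + 1 := by
  refine ⟨⋃ y ∈ R, ⋃ y' ∈ R, {g | r y (g • y')}, ?_, fun n g hg => ?_⟩
  · refine hR.biUnion fun y _ => hR.biUnion fun y' hy' => ?_
    have : {g : G | r y (g • y')} = ⋃ b ∈ {b | r y b}, {g : G | g • y' = b} := by
      ext g; simp
    rw [this]
    refine (hlf y).biUnion fun b _ => ?_
    by_cases h : ∃ g₀ : G, g₀ • y' = b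
    · obtain ⟨g₀, rfl⟩ := h
      refine ((hst y').image fun g => g₀ * g).subset fun g hg => ⟨g₀⁻¹ * g, ?_, ?_⟩
      · change (g₀⁻¹ * g) • y' = y'
        rw [mul_smul, inv_smul_eq_iff]
        exact hg
      · simp
    · convert Set.finite_empty
      exact Set.eq_empty_of_forall_notMem fun g hg => h ⟨g, hg⟩
  · have key : ∀ (m : ℕ) (b c : Y), IsStepChain r m b c → b = o → ∃ y ∈ R, ∃ h : G, h • y = c ∧
        ∃ l : List G, (∀ x ∈ l, x ∈ ⋃ y ∈ R, ⋃ y' ∈ R, {g | r y (g • y')}) ∧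
          l.prod = h ∧ l.length = m := by
      intro m b c hbc hb
      induction hbc with
      | refl a => exact ⟨o, ho, 1, by rw [one_smul, hb], [], by simp, rfl, rfl⟩
      | @tail k a b c _ hbc ih =>
        obtain ⟨y, hy, h, rfl, l, h1, h2, h3⟩ := ih hb
        obtain ⟨y', hy', h', rfl⟩ := hcov _ _ hbc
        refine ⟨y', hy', h', rfl, l ++ [h⁻¹ * h'], ?_, by simp [h2], by simp [h3]⟩
        intro x hx
        rw [List.mem_append, List.mem_singleton] at hx
        rcases hx with hx | rfl
        · exact h1 x hx
        · simp only [Set.mem_iUnion]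
          refine ⟨y, hy, y', hy', ?_⟩
          have := hr h⁻¹ _ _ hbc
          rwa [inv_smul_smul, ← mul_smul] at this
    obtain ⟨y, hy, h, h1, l, h2, h3, h4⟩ := key n o _ hg rfl
    -- The chain ends at `h • y = g • o`, where `h` may differ from `g`; one extra letter corrects
    -- this, whence `n + 1`.
    refine ⟨l ++ [h⁻¹ * g], ?_, by simp [h3], by simp [h4]⟩
    intro x hx
    rw [List.mem_append, List.mem_singleton] at hx
    rcases hx with hx | rfl
    · exact h2 x hx
    · simp only [Set.mem_iUnion]
      refine ⟨y, hy, o, ho, ?_⟩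
      change r y ((h⁻¹ * g) • o)
      rw [mul_smul, ← h1, inv_smul_smul]
      exact hRr y hy

end WordLength

/-! ### Actions on one building -/

section Displacement

variable {B W : Type*} [Group W] {M : CoxeterMatrix B} {cs : CoxeterSystem M W} {X : Type*}
  {Δ : Building cs X} {G : Type*} [Group G] [MulAction G X]

theorem Building.length_δ_mul_smul_le (h : ∀ (g : G) (c d : X), Δ.δ (g • c) (g • d) = Δ.δ c d)
    (c : X) (g k : G) : cs.length (Δ.δ c ((g * k) • c)) ≤
      cs.length (Δ.δ c (g • c)) + cs.length (Δ.δ c (k • c)) := by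
  have := Δ.length_δ_triangle c (g • c) ((g * k) • c)
  rw [mul_smul] at this ⊢
  rwa [h] at this

theorem Building.length_δ_inv_smul (h : ∀ (g : G) (c d : X), Δ.δ (g • c) (g • d) = Δ.δ c d)
    (c : X) (g : G) : cs.length (Δ.δ c (g⁻¹ • c)) = cs.length (Δ.δ c (g • c)) := by
  rw [← h g, smul_inv_smul, Building.length_δ_symm]

theorem Building.IsStronglyTransitive.closure_smul_mem_ball (h : Δ.IsStronglyTransitive G) (c : X) :
    Subgroup.closure {g : G | cs.length (Δ.δ c (g • c)) ≤ 1} = ⊤ := by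
  rw [Subgroup.eq_top_iff']
  intro g
  induction hn : cs.length (Δ.δ c (g • c)) generalizing g with
  | zero => exact Subgroup.subset_closure (by simp [hn])
  | succ n ih =>
    have hne : Δ.δ c (g • c) ≠ 1 := fun h1 => by simp [h1] at hn
    obtain ⟨i, e, h1, h2, h3⟩ := Δ.exists_adjacent_toward hne
    have := h.isPretransitive
    obtain ⟨k, rfl⟩ := MulAction.exists_smul_eq G c e
    have hk : k ∈ Subgroup.closure {g : G | cs.length (Δ.δ c (g • c)) ≤ 1} :=
      Subgroup.subset_closure (by simp [h1, cs.length_simple])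
    have := ih (k⁻¹ * g) (by rw [← h.1 k, smul_smul, mul_inv_cancel_left]; omega)
    simpa using mul_mem hk this

variable [TopologicalSpace G] [IsTopologicalGroup G]

theorem HasCompactOpenStabilizers.isCompact_smul_mem (h : HasCompactOpenStabilizers G X) (c : X)
    {F : Set X} (hF : F.Finite) : IsCompact {g : G | g • c ∈ F} := by
  have : {g : G | g • c ∈ F} = ⋃ x ∈ F, {g : G | g • c = x} := by ext; simp
  rw [this]
  refine hF.isCompact_biUnion fun x _ => ?_
  by_cases hx : ∃ g₀ : G, g₀ • c = x
  · obtain ⟨g₀, rfl⟩ := hx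
    convert (h c).2.image (continuous_const_mul g₀) using 1
    ext g
    constructor
    · intro hg
      refine ⟨g₀⁻¹ * g, ?_, by simp⟩
      change (g₀⁻¹ * g) • c = c
      rw [mul_smul, inv_smul_eq_iff]
      exact hg
    · rintro ⟨k, hk, rfl⟩
      change (g₀ * k) • c = g₀ • c
      rw [mul_smul, show k • c = c from hk]
  · convert isCompact_empty
    exact Set.eq_empty_of_forall_notMem fun g hg => hx ⟨g, hg⟩

theorem HasCompactOpenStabilizers.exists_bound (h : HasCompactOpenStabilizers G X) (c : X)
    (f : X → ℕ) {T : Set G} (hT : IsCompact T) : ∃ K, ∀ g ∈ T, f (g • c) ≤ K := by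
  have hc : IsLocallyConstant fun g : G => f (g • c) := by
    rw [IsLocallyConstant.iff_exists_open]
    intro g
    refine ⟨{k | g⁻¹ * k ∈ MulAction.stabilizer G c},
      (h c).1.preimage (continuous_const_mul g⁻¹), by simp, fun k hk => ?_⟩
    have hk : (g⁻¹ * k) • c = c := hk
    rw [mul_smul, inv_smul_eq_iff] at hk
    simp only [hk]
  obtain ⟨K, hK⟩ := (hT.image hc.continuous).bddAbove
  exact ⟨K, fun g hg => hK ⟨g, hg, rfl⟩⟩

end Displacement

/-! ### Residues of thin type -/

section Thin

variable {B W : Type*} [Group W] {M : CoxeterMatrix B} {cs : CoxeterSystem M W} {X : Type*}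

/-- The types of the panels with exactly two chambers. -/
def Building.thinTypes (Δ : Building cs X) : Set B :=
  {i | ∀ a b b' : X, Δ.δ a b = cs.simple i → Δ.δ a b' = cs.simple i → b = b'}

/-- The chambers at distance at most one from the residue of type `I` of `c`. -/
def Building.residueNeighbors (Δ : Building cs X) (I : Set B) (c : X) : Set X :=
  {y | ∃ x, Δ.InResidue I c x ∧ cs.length (Δ.δ x y) ≤ 1}

variable {Δ : Building cs X}

theorem Building.fixesAround_of_residueNeighbors {I : Set B} {φ : X → X} {c : X}
    (h : ∀ y ∈ Δ.residueNeighbors I c, φ y = y) : Δ.FixesAround I φ c :=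
  fun x hx => ⟨h x ⟨x, hx, by simp [Δ.δ_self]⟩,
    fun y i hy => h y ⟨x, hx, by simp [hy, cs.length_simple]⟩⟩

theorem Building.finite_residueNeighbors (hf : Δ.IsLocallyFinite) {I : Set B} {c : X}
    (h : {x | Δ.InResidue I c x}.Finite) : (Δ.residueNeighbors I c).Finite := by
  refine (h.biUnion fun x _ => Δ.finite_ball hf x).subset ?_
  rintro y ⟨x, hx, hy⟩
  simp only [Set.mem_iUnion]
  exact ⟨x, hx, hy⟩

variable {G : Type*} [Group G] [MulAction G X]

theorem Building.IsStronglyTransitive.exists_ne_adjacent (h : Δ.IsStronglyTransitive G) :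
    ∀ j ∉ Δ.thinTypes, ∀ a b : X, Δ.δ a b = cs.simple j → ∃ e ≠ b, Δ.δ a e = cs.simple j := by
  intro j hj a b _
  simp only [Building.thinTypes, Set.mem_ofPred_eq, not_forall] at hj
  obtain ⟨a₀, b₀, b₁, h0, h1, hne⟩ := hj
  have := h.isPretransitive
  obtain ⟨g, rfl⟩ := MulAction.exists_smul_eq G a₀ a
  by_cases hb : g • b₀ = b
  · refine ⟨g • b₁, fun h2 => hne ?_, by rw [h.1, h1]⟩
    rw [← h2] at hb
    exact MulAction.injective g hb
  · exact ⟨g • b₀, hb, by rw [h.1, h0]⟩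

theorem Building.InResidue.smul (h : ∀ (g : G) (c d : X), Δ.δ (g • c) (g • d) = Δ.δ c d)
    {I : Set B} {c x : X} (hx : Δ.InResidue I c x) (g : G) :
    Δ.InResidue I (g • c) (g • x) := by
  induction hx with
  | refl => exact .refl
  | tail _ hab ih =>
    obtain ⟨i, hi, hab⟩ := hab
    exact ih.tail ⟨i, hi, by rw [h, hab]⟩

theorem Building.smul_mem_residueNeighbors
    (h : ∀ (g : G) (c d : X), Δ.δ (g • c) (g • d) = Δ.δ c d) {I : Set B} {c y : X}
    (hy : y ∈ Δ.residueNeighbors I c) (g : G) : g • y ∈ Δ.residueNeighbors I (g • c) := by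
  obtain ⟨x, hx, hxy⟩ := hy
  exact ⟨g • x, hx.smul h g, by rwa [h]⟩

theorem Building.residueNeighbors_smul
    (h : ∀ (g : G) (c d : X), Δ.δ (g • c) (g • d) = Δ.δ c d) (I : Set B) (c : X) (g : G) :
    Δ.residueNeighbors I (g • c) = (g • ·) '' Δ.residueNeighbors I c := by
  ext y
  constructor
  · intro hy
    have := Building.smul_mem_residueNeighbors h hy g⁻¹
    rw [inv_smul_smul] at this
    exact ⟨_, this, smul_inv_smul g y⟩
  · rintro ⟨y, hy, rfl⟩
    exact Building.smul_mem_residueNeighbors h hy g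

theorem Building.InResidue.smul_eq_self_iff
    (h : ∀ (g : G) (c d : X), Δ.δ (g • c) (g • d) = Δ.δ c d)
    {c x : X} (hx : Δ.InResidue Δ.thinTypes c x) (g : G) : g • x = x ↔ g • c = c := by
  induction hx with
  | refl => rfl
  | @tail a b _ hab ih =>
    obtain ⟨i, hi, hab⟩ := hab
    have hba := Building.δ_simple_symm hab
    rw [← ih]
    constructor
    · intro hb
      exact hi b _ _ (by rw [← hba, ← h g b a, hb]) hba
    · intro ha
      exact hi a _ _ (by rw [← hab, ← h g a b, ha]) hab

/-- In a two-chamber panel the neighbours supplied by the building axiom and by the twinning axiom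
coincide, so both sides change alike. -/
theorem Twinning.δ_eq_δs_of_inResidue {Xm : Type*} {Δm : Building cs Xm} (τ : Twinning Δ Δm)
    {c x : X} {d : Xm} (hcd : τ.δs c d = 1) (hx : Δ.InResidue Δ.thinTypes c x) :
    Δ.δ x c = τ.δs x d := by
  induction hx with
  | refl => rw [hcd, Δ.δ_self]
  | @tail a b _ hab ih =>
    obtain ⟨i, hi, hab⟩ := hab
    obtain ⟨b₁, h1, h2⟩ := Δ.exists_δ a c i
    obtain ⟨b₂, h3, h4⟩ := τ.pos_exists a d i
    obtain rfl := hi a b₁ b (Building.δ_simple_symm h1) hab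
    obtain rfl := hi a b₂ b₁ (Building.δ_simple_symm h3) hab
    rw [h2, h4, ih]

end Thin

/-! ### Actions of products -/

section Prod

variable {G H X Y : Type*} [Group G] [Group H] [MulAction G X] [MulAction H Y]

/-- The componentwise action of a product of groups on a product of sets. -/
instance prodComponentwiseMulAction : MulAction (G × H) (X × Y) where
  smul g p := (g.1 • p.1, g.2 • p.2)
  one_smul p := by
    change ((1 : G) • p.1, (1 : H) • p.2) = p
    simp
  mul_smul g h p := by
    change ((g.1 * h.1) • p.1, (g.2 * h.2) • p.2) = (g.1 • h.1 • p.1, g.2 • h.2 • p.2)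
    simp [mul_smul]

theorem prod_smul_def (g : G × H) (p : X × Y) : g • p = (g.1 • p.1, g.2 • p.2) := rfl

theorem prod_smul_eq_iff {g : G × H} {p q : X × Y} :
    g • p = q ↔ g.1 • p.1 = q.1 ∧ g.2 • p.2 = q.2 := by
  rw [prod_smul_def, Prod.ext_iff]

theorem coe_stabilizer_prod (p : X × Y) : (MulAction.stabilizer (G × H) p : Set (G × H)) =
    (MulAction.stabilizer G p.1 : Set G) ×ˢ (MulAction.stabilizer H p.2 : Set H) := by
  ext g
  exact prod_smul_eq_iff

theorem orbit_stabilizer_prod (p q : X × Y) :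
    MulAction.orbit (MulAction.stabilizer (G × H) p) q =
      MulAction.orbit (MulAction.stabilizer G p.1) q.1 ×ˢ
        MulAction.orbit (MulAction.stabilizer H p.2) q.2 := by
  ext x
  constructor
  · rintro ⟨⟨g, hg⟩, rfl⟩
    have hg := prod_smul_eq_iff.1 hg
    exact ⟨⟨⟨g.1, hg.1⟩, rfl⟩, ⟨⟨g.2, hg.2⟩, rfl⟩⟩
  · rintro ⟨⟨⟨g, hg⟩, h1⟩, ⟨⟨h, hh⟩, h2⟩⟩
    exact ⟨⟨(g, h), prod_smul_eq_iff.2 ⟨hg, hh⟩⟩, Prod.ext h1 h2⟩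

instance isPretransitive_prod [MulAction.IsPretransitive G X] [MulAction.IsPretransitive H Y] :
    MulAction.IsPretransitive (G × H) (X × Y) where
  exists_smul_eq p q := by
    obtain ⟨g, hg⟩ := MulAction.exists_smul_eq G p.1 q.1
    obtain ⟨h, hh⟩ := MulAction.exists_smul_eq H p.2 q.2
    exact ⟨(g, h), prod_smul_eq_iff.2 ⟨hg, hh⟩⟩

end Prod

/-! ### Twin building lattices -/

namespace IsTwinBuildingLattice

variable {B W : Type*} [Group W] {M : CoxeterMatrix B} {cs : CoxeterSystem M W}
  {Xp Xm : Type*} {Δp : Building cs Xp} {Δm : Building cs Xm} {τ : Twinning Δp Δm}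
  {Gp Gm : Type*} [Group Gp] [TopologicalSpace Gp]
  [Group Gm] [TopologicalSpace Gm]
  [MulAction Gp Xp] [MulAction Gm Xm] {Γ : Subgroup (Gp × Gm)}

theorem isAut (h : IsTwinBuildingLattice τ Γ) {γ : Gp × Gm} (hγ : γ ∈ Γ) :
    τ.IsAut (γ.1 • ·) (γ.2 • ·) :=
  ⟨h.stronglyTransitive_pos.1 γ.1, h.stronglyTransitive_neg.1 γ.2, h.preserves γ hγ⟩

variable [IsTopologicalGroup Gp] [IsTopologicalGroup Gm]

theorem exists_finite_representatives (h : IsTwinBuildingLattice τ Γ) {K : ℕ} {Q : Set (Xp × Xm)}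
    (hQ : ∀ p ∈ Q, {γ | γ ∈ Γ ∧ γ • p = p}.Finite ∧ {γ | γ ∈ Γ ∧ γ • p = p}.ncard ≤ K) :
    ∃ R ⊆ Q, R.Finite ∧ ∀ p ∈ Q, ∃ r ∈ R, ∃ γ ∈ Γ, γ • r = p := by
  have hp := h.stronglyTransitive_pos
  have hm := h.stronglyTransitive_neg
  have := Δp.countable_of_isLocallyFinite h.locallyFinite_pos
  have := Δm.countable_of_isLocallyFinite h.locallyFinite_neg
  have := hp.isPretransitive
  have := hm.isPretransitive
  refine h.lattice.exists_finite_representatives (fun y => ?_) (fun p q => ?_) (fun p q => ?_) hQ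
  · rw [coe_stabilizer_prod]
    exact (h.proper_pos y.1).1.prod (h.proper_neg y.2).1
  · rw [orbit_stabilizer_prod]
    exact (hp.finite_orbit_stabilizer h.locallyFinite_pos _ _).prod
      (hm.finite_orbit_stabilizer h.locallyFinite_neg _ _)
  · rw [orbit_stabilizer_prod, orbit_stabilizer_prod, Set.ncard_prod, Set.ncard_prod,
      hp.card_orbit_stabilizer_comm h.locallyFinite_pos,
      hm.card_orbit_stabilizer_comm h.locallyFinite_neg]

theorem exists_compact_generating (h : IsTwinBuildingLattice τ Γ) :
    ∃ T : Set (Gp × Gm), IsCompact T ∧ IsGenerating T := by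
  obtain ⟨c⟩ := Δp.nonempty
  obtain ⟨d⟩ := Δm.nonempty
  refine ⟨{g : Gp | cs.length (Δp.δ c (g • c)) ≤ 1} ×ˢ {g : Gm | cs.length (Δm.δ d (g • d)) ≤ 1},
    (h.proper_pos.isCompact_smul_mem c (Δp.finite_ball h.locallyFinite_pos c)).prod
      (h.proper_neg.isCompact_smul_mem d (Δm.finite_ball h.locallyFinite_neg d)), ?_⟩
  rw [IsGenerating, Subgroup.closure_prod (by simp [Building.δ_self]) (by simp [Building.δ_self]),
    h.stronglyTransitive_pos.closure_smul_mem_ball, h.stronglyTransitive_neg.closure_smul_mem_ball,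
    Subgroup.top_prod_top]

theorem finite_stabilizer [T2Space Gp] [T2Space Gm] (h : IsTwinBuildingLattice τ Γ)
    (p : Xp × Xm) : {γ | γ ∈ Γ ∧ γ • p = p}.Finite := by
  have := h.lattice.1
  have hcl : IsClosed (Γ : Set (Gp × Gm)) := Subgroup.isClosed_of_discrete
  have hc : IsCompact (MulAction.stabilizer (Gp × Gm) p : Set (Gp × Gm)) := by
    rw [coe_stabilizer_prod]
    exact (h.proper_pos p.1).2.prod (h.proper_neg p.2).2
  have hd : IsDiscrete (Γ : Set (Gp × Gm)) := isDiscrete_iff_discreteTopology.2 this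
  exact ((hc.inter_left hcl).finite (hd.mono Set.inter_subset_left)).subset fun γ hγ => hγ

variable [T2Space Gp] [T2Space Gm]

/-- The residues of thin type are finite, since the lattice has finite covolume. -/
theorem finite_thin_residue (h : IsTwinBuildingLattice τ Γ) (c : Xp) :
    {x | Δp.InResidue Δp.thinTypes c x}.Finite := by
  obtain ⟨d, hd⟩ := τ.swap.exists_opposite c
  rw [τ.swap_δs_eq_one_iff] at hd
  have hst : ∀ x, Δp.InResidue Δp.thinTypes c x →
      {γ | γ ∈ Γ ∧ γ • (x, d) = (x, d)} = {γ | γ ∈ Γ ∧ γ • (c, d) = (c, d)} := by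
    intro x hx
    ext γ
    simp only [Set.mem_ofPred_eq, prod_smul_eq_iff,
      hx.smul_eq_self_iff h.stronglyTransitive_pos.1]
  obtain ⟨R, hRQ, hR, hcov⟩ := h.exists_finite_representatives
    (K := {γ | γ ∈ Γ ∧ γ • (c, d) = (c, d)}.ncard)
    (Q := {p | Δp.InResidue Δp.thinTypes c p.1 ∧ p.2 = d}) (by
      rintro ⟨x, _⟩ ⟨hx, rfl⟩
      exact ⟨h.finite_stabilizer _, (congrArg Set.ncard (hst x hx)).le⟩)
  -- The codistance is constant on `Γ`-orbits and on these pairs it is the distance to `c`, so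
  -- finitely many orbits confine `x` to finitely many spheres.
  refine (hR.biUnion fun r _ =>
    Δp.finite_sphere h.locallyFinite_pos c (τ.δs r.1 r.2)⁻¹).subset fun x hx => ?_
  obtain ⟨r, hr, γ, hγ, hγr⟩ := hcov (x, d) ⟨hx, rfl⟩
  simp only [Set.mem_iUnion]
  refine ⟨r, hr, ?_⟩
  have hγr := prod_smul_eq_iff.1 hγr
  rw [Set.mem_ofPred_eq, Δp.δ_symm, τ.δ_eq_δs_of_inResidue hd hx, ← h.preserves γ hγ r.1 r.2,
    hγr.1, hγr.2]

/-- The stabilizers of the opposite pairs have bounded order. -/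
theorem exists_card_stabilizer_le (h : IsTwinBuildingLattice τ Γ) :
    ∃ K, ∀ p : Xp × Xm, τ.δs p.1 p.2 = 1 → {γ | γ ∈ Γ ∧ γ • p = p}.ncard ≤ K := by
  classical
  have hp := h.stronglyTransitive_pos
  have hF : ∀ c, (Δp.residueNeighbors Δp.thinTypes c).Finite := fun c =>
    Building.finite_residueNeighbors h.locallyFinite_pos (h.finite_thin_residue c)
  obtain ⟨c₀⟩ := Δp.nonempty
  obtain ⟨d₀⟩ := Δm.nonempty
  let N : Set (Gp × Gm) := {γ | γ ∈ Γ ∧ (∀ x : Xp, γ.1 • x = x) ∧ ∀ y : Xm, γ.2 • y = y}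
  have hN : N.Finite := (h.finite_stabilizer (c₀, d₀)).subset fun γ hγ =>
    ⟨hγ.1, prod_smul_eq_iff.2 ⟨hγ.2.1 _, hγ.2.2 _⟩⟩
  let m := (Δp.residueNeighbors Δp.thinTypes c₀).ncard
  -- At most `m ^ m` maps arise by restriction to the `m` chambers near the thin residue of `c`; by
  -- rigidity each fibre lies in a coset of the kernel `N`. By transitivity `m` does not depend on
  -- `c`.
  refine ⟨N.ncard * m ^ m, fun p hop => ?_⟩
  obtain ⟨c, d⟩ := p
  have hm : (hF c).toFinset.card = m := by
    have := hp.isPretransitive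
    obtain ⟨g, rfl⟩ := MulAction.exists_smul_eq Gp c₀ c
    rw [← Set.ncard_eq_toFinset_card _ (hF _), Building.residueNeighbors_smul hp.1,
      Set.ncard_image_of_injective _ (MulAction.injective g)]
  have hS := h.finite_stabilizer (c, d)
  rw [Set.ncard_eq_toFinset_card _ hS]
  have hcount := Finset.card_le_mul_card_image_of_maps_to (s := hS.toFinset)
    (f := fun γ (y : (hF c).toFinset) => γ.1 • (y : Xp))
    (t := Fintype.piFinset fun _ => (hF c).toFinset) (fun γ hγ => ?_) N.ncard (fun b _ => ?_)
  · simpa [Fintype.card_piFinset_const, hm] using hcount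
  · rw [Fintype.mem_piFinset]
    intro y
    have hγc : γ.1 • c = c := (prod_smul_eq_iff.1 (hS.mem_toFinset.1 hγ).2).1
    rw [Set.Finite.mem_toFinset]
    have := Building.smul_mem_residueNeighbors hp.1 ((hF c).mem_toFinset.1 y.2) γ.1
    rwa [hγc] at this
  · rcases ({γ ∈ hS.toFinset | (fun y : (hF c).toFinset => γ.1 • (y : Xp)) = b} :
      Finset (Gp × Gm)).eq_empty_or_nonempty with he | ⟨γ₀, hγ₀⟩
    · rw [he]
      simp
    · rw [Set.ncard_eq_toFinset_card _ hN]
      refine Finset.card_le_card_of_injOn (fun γ => γ₀⁻¹ * γ) (fun γ hγ => ?_)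
        (mul_right_injective γ₀⁻¹).injOn
      rw [Finset.mem_coe, Finset.mem_filter, Set.Finite.mem_toFinset] at hγ
      rw [Finset.mem_filter, Set.Finite.mem_toFinset] at hγ₀
      rw [Finset.mem_coe, Set.Finite.mem_toFinset]
      have hmem : γ₀⁻¹ * γ ∈ Γ := mul_mem (inv_mem hγ₀.1.1) hγ.1.1
      have hfix : (γ₀⁻¹ * γ) • (c, d) = (c, d) := by
        rw [mul_smul, hγ.1.2, inv_smul_eq_iff, hγ₀.1.2]
      refine ⟨hmem, (h.isAut hmem).eq_id hp.exists_ne_adjacent hop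
        (Building.fixesAround_of_residueNeighbors fun y hy => ?_) (prod_smul_eq_iff.1 hfix).2⟩
      have h1 := congrFun (hγ.2.trans hγ₀.2.symm) ⟨y, (hF c).mem_toFinset.2 hy⟩
      change (γ₀⁻¹ * γ).1 • y = y
      rw [Prod.fst_mul, Prod.fst_inv, mul_smul, inv_smul_eq_iff]
      exact h1

/-- The lattice acts cocompactly on the set of opposite pairs. -/
theorem exists_finite_opposite_representatives (h : IsTwinBuildingLattice τ Γ) :
    ∃ R : Set (Xp × Xm), R.Finite ∧ (∀ r ∈ R, τ.δs r.1 r.2 = 1) ∧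
      ∀ p : Xp × Xm, τ.δs p.1 p.2 = 1 → ∃ r ∈ R, ∃ γ ∈ Γ, γ • r = p := by
  obtain ⟨K, hK⟩ := h.exists_card_stabilizer_le
  obtain ⟨R, h1, h2, h3⟩ := h.exists_finite_representatives (K := K)
    (Q := {p | τ.δs p.1 p.2 = 1}) fun p hp => ⟨h.finite_stabilizer p, hK p hp⟩
  exact ⟨R, h2, fun r hr => h1 hr, h3⟩

theorem exists_finite_list (h : IsTwinBuildingLattice τ Γ) {o : Xp × Xm}
    (ho : τ.δs o.1 o.2 = 1) : ∃ T : Set Γ, T.Finite ∧ ∀ γ : Γ,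
      ∃ l : List Γ, (∀ x ∈ l, x ∈ T) ∧ l.prod = γ ∧
        l.length ≤ 2 * (cs.length (Δp.δ o.1 ((γ : Gp × Gm).1 • o.1)) +
          cs.length (Δm.δ o.2 ((γ : Gp × Gm).2 • o.2))) + 1 := by
  obtain ⟨R, h1, h2, h3⟩ := h.exists_finite_opposite_representatives
  have hrefl : ∀ p : Xp × Xm, τ.δs p.1 p.2 = 1 → τ.OppositeStep p p := fun p hp =>
    ⟨⟨hp, hp⟩, by simp [Building.δ_self], by simp [Building.δ_self]⟩
  have hinv : ∀ (γ : Γ) a b, τ.OppositeStep a b → τ.OppositeStep (γ • a) (γ • b) := by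
    rintro γ a b ⟨⟨h4, h5⟩, h6, h7⟩
    refine ⟨⟨(h.preserves γ γ.2 _ _).trans h4, (h.preserves γ γ.2 _ _).trans h5⟩, ?_, ?_⟩
    · exact (congrArg cs.length (h.stronglyTransitive_pos.1 (γ : Gp × Gm).1 _ _)).le.trans h6
    · exact (congrArg cs.length (h.stronglyTransitive_neg.1 (γ : Gp × Gm).2 _ _)).le.trans h7
  have hlf : ∀ a, {b | τ.OppositeStep a b}.Finite := fun a =>
    ((Δp.finite_ball h.locallyFinite_pos a.1).prod
      (Δm.finite_ball h.locallyFinite_neg a.2)).subset fun b hb => hb.2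
  have hst : ∀ b : Xp × Xm, {γ : Γ | γ • b = b}.Finite := fun b => by
    refine Set.Finite.of_finite_image (f := Subtype.val)
      ((h.finite_stabilizer b).subset ?_) Subtype.val_injective.injOn
    rintro _ ⟨γ, hγ, rfl⟩
    exact ⟨γ.2, hγ⟩
  have hins : ∀ y ∈ insert o R, τ.OppositeStep y y := by
    rintro y (rfl | hy)
    · exact hrefl _ ho
    · exact hrefl _ (h2 y hy)
  have hcov : ∀ a b, τ.OppositeStep a b → ∃ y ∈ insert o R, ∃ γ : Γ, γ • y = b := by
    intro a b hab
    obtain ⟨r, hr, γ, hγ, hγr⟩ := h3 b hab.1.2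
    exact ⟨r, Or.inr hr, ⟨γ, hγ⟩, hγr⟩
  obtain ⟨T, hT, hl⟩ := exists_finite_list_of_isStepChain hinv hlf hst
    (h1.insert o) hins hcov (Set.mem_insert _ _)
  refine ⟨T, hT, fun γ => ?_⟩
  obtain ⟨n, hn, hch⟩ := τ.exists_chain_opposite (c' := (γ : Gp × Gm).1 • o.1)
    (d' := (γ : Gp × Gm).2 • o.2) ho ((h.preserves γ γ.2 _ _).trans ho)
  obtain ⟨l, h4, h5, h6⟩ := hl n γ hch
  exact ⟨l, h4, h5, by omega⟩

end IsTwinBuildingLattice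

/-! ### Comparison of the word metrics -/

theorem theorem1 {B W : Type*} [Group W] {M : CoxeterMatrix B} {cs : CoxeterSystem M W}
    {Xp Xm : Type*} {Δp : Building cs Xp} {Δm : Building cs Xm} (τ : Twinning Δp Δm)
    {Gp Gm : Type*} [Group Gp] [TopologicalSpace Gp] [IsTopologicalGroup Gp] [T2Space Gp]
    [LocallyCompactSpace Gp]
    [Group Gm] [TopologicalSpace Gm] [IsTopologicalGroup Gm] [T2Space Gm]
    [LocallyCompactSpace Gm]
    [MulAction Gp Xp] [MulAction Gm Xm]
    (Γ : Subgroup (Gp × Gm)) (hΓ : IsTwinBuildingLattice τ Γ) :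
    Γ.IsUndistorted := by
  obtain ⟨d⟩ := Δm.nonempty
  obtain ⟨c, hcd⟩ := τ.exists_opposite d
  obtain ⟨T, hT, hl⟩ := hΓ.exists_finite_list (o := (c, d)) hcd
  refine ⟨⟨T, hT, ?_⟩, hΓ.exists_compact_generating, fun S T' hS hSg hT' hTg' => ?_⟩
  · rw [IsGenerating, Subgroup.eq_top_iff']
    intro γ
    obtain ⟨l, h1, rfl, -⟩ := hl γ
    exact Subgroup.list_prod_mem _ fun x hx => Subgroup.subset_closure (h1 x hx)
  · have hp := hΓ.stronglyTransitive_pos.1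
    have hm := hΓ.stronglyTransitive_neg.1
    -- The displacement of the base pair mediates between the two word lengths.
    let D : Gp × Gm → ℕ := fun g =>
      cs.length (Δp.δ c (g.1 • c)) + cs.length (Δm.δ d (g.2 • d))
    have hD1 : D 1 = 0 := by simp [D, Building.δ_self]
    have hDmul : ∀ g k, D (g * k) ≤ D g + D k := fun g k => by
      have h1 := Building.length_δ_mul_smul_le hp c g.1 k.1
      have h2 := Building.length_δ_mul_smul_le hm d g.2 k.2
      simp only [D, Prod.fst_mul, Prod.snd_mul]
      omega
    have hDinv : ∀ g, D g⁻¹ ≤ D g := fun g => by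
      have h1 := Building.length_δ_inv_smul hp c g.1
      have h2 := Building.length_δ_inv_smul hm d g.2
      simp only [D, Prod.fst_inv, Prod.snd_inv]
      omega
    obtain ⟨K₁, hK₁⟩ := hS.exists_nat_bound fun γ : Γ => wordLength T' (γ : Gp × Gm)
    obtain ⟨A, hA⟩ := hΓ.proper_pos.exists_bound c (fun x => cs.length (Δp.δ c x))
      (hT'.image continuous_fst)
    obtain ⟨A', hA'⟩ := hΓ.proper_neg.exists_bound d (fun x => cs.length (Δm.δ d x))
      (hT'.image continuous_snd)
    -- `K₃` converts words in the geometric generating set `T` into words in the given `S`.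
    obtain ⟨K₃, hK₃⟩ := hT.exists_nat_bound fun γ : Γ => wordLength S γ
    have hDT : ∀ g ∈ T', D g ≤ A + A' := fun g hg =>
      add_le_add (hA _ ⟨g, hg, rfl⟩) (hA' _ ⟨g, hg, rfl⟩)
    have hup : ∀ γ : Γ, wordLength T' (γ : Gp × Gm) ≤ K₁ * wordLength S γ :=
      hSg.apply_le_mul_wordLength (f := fun γ : Γ => wordLength T' (γ : Gp × Gm))
        wordLength_one (fun g k => hTg'.wordLength_mul_le _ _)
        (fun g => hTg'.wordLength_inv_le _) hK₁
    have hlow : ∀ γ : Γ, wordLength S γ ≤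
        2 * K₃ * (A + A') * wordLength T' (γ : Gp × Gm) + K₃ := by
      intro γ
      obtain ⟨l, h1, h2, h3⟩ := hl γ
      have h4 : wordLength S γ ≤ K₃ * l.length := by
        rw [← h2]
        exact apply_list_prod_le wordLength_one hSg.wordLength_mul_le fun x hx => hK₃ x (h1 x hx)
      have h5 : D γ ≤ (A + A') * wordLength T' (γ : Gp × Gm) :=
        hTg'.apply_le_mul_wordLength hD1 hDmul hDinv hDT _
      calc _ ≤ K₃ * l.length := h4
        _ ≤ K₃ * (2 * ((A + A') * wordLength T' (γ : Gp × Gm)) + 1) := by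
            refine Nat.mul_le_mul_left _ (h3.trans ?_)
            change 2 * D γ + 1 ≤ _
            omega
        _ = _ := by ring
    -- One constant serves both inequalities; the summand `1` ensures that it is at least `1`.
    refine ⟨1 + K₁ + 2 * K₃ * (A + A'), K₃, by norm_cast; omega, by positivity, fun γ γ' => ?_⟩
    have h1 : (wordLength T' ((γ : Gp × Gm)⁻¹ * γ') : ℝ) ≤ K₁ * wordLength S (γ⁻¹ * γ') := by
      exact_mod_cast hup (γ⁻¹ * γ')
    have h2 : (wordLength S (γ⁻¹ * γ') : ℝ) ≤
        2 * K₃ * (A + A') * wordLength T' ((γ : Gp × Gm)⁻¹ * γ') + K₃ := by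
      exact_mod_cast hlow (γ⁻¹ * γ')
    simp only [wordDist]
    set a : ℝ := (wordLength S (γ⁻¹ * γ') : ℝ)
    set b : ℝ := (wordLength T' ((γ : Gp × Gm)⁻¹ * γ') : ℝ)
    have ha : 0 ≤ a := Nat.cast_nonneg _
    have hb : 0 ≤ b := Nat.cast_nonneg _
    have hL : (1 : ℝ) ≤ 1 + K₁ + 2 * K₃ * (A + A') := by norm_cast; omega
    have hK₁' : (0 : ℝ) ≤ K₁ := Nat.cast_nonneg _
    have hK₃' : (0 : ℝ) ≤ K₃ := Nat.cast_nonneg _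
    have hAA : (0 : ℝ) ≤ 2 * K₃ * (A + A') := by positivity
    constructor
    · rw [sub_le_iff_le_add, inv_mul_le_iff₀ (by linarith)]
      nlinarith [mul_nonneg hK₁' hb, mul_nonneg hK₁' hK₃', mul_nonneg hAA hK₃']
    · nlinarith [mul_nonneg hAA ha]
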